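/- **RPTree-Max.** Let $D \ge 0$ and let $S\subset\mathbb R^D$ be a finite data set. An RPTree-Max on $S$ is the random binary tree of cells (regions of $\mathbb R^D$) built as follows. The root cell is $\mathbb R^D$. A cell $C$ is split by choosing a direction $v$ uniformly at random on the unit sphere of $\mathbb R^D$, picking an arbitrary data point $p\in S\cap C$, setting $\tilde\Delta=\max\{\|p-y\| : y\in S\cap C\}$, choosing $\delta$ uniformly at random in $[-1,1]\cdot 6\tilde\Delta/\sqrt D$, and sending $x\in C$ to the left child if $x\cdot v<\mathrm{median}\{z\cdot v: z\in S\cap C\}+\delta$ and to the right child otherwise; all random choices are independent. (For an even number of values the median is the mean of the two middle ones.) The radius of a cell $C$ is the radius of the smallest ball that contains $S\cap C$ ($0$ if $S\cap C=\emptyset$). The doubling dimension of a set $A\subset\mathbb R^D$ is the smallest integer $d\ge 0$ such that for every closed ball $B(x,r)\subset\mathbb R^D$ the set $B(x,r)\cap A$ can be covered by $2^d$ balls of radius $r/2$. **Theorem.** There is an absolute constant $c_2>0$ with the following property. Suppose an RPTree-Max is built using a finite data set $S\subset\mathbb R^D$. Pick any cell $C$ of the tree, and suppose that $S\cap C$ has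 doubling dimension at most $d$, where $d\ge 2$ is an integer. Then for any real $s\ge 2$, with probability at least $1-1/4$ over the randomization in constructing the subtree rooted at $C$ (for any fixed outcome of the random choices made outside this subtree), every descendant $C'$ of $C$ that lies more than $c_2\cdot s\cdot d\log d$ levels below $C$ satisfies $\mathrm{radius}(C')\le \mathrm{radius}(C)/s$. -/

import Mathlib

open MeasureTheory ProbabilityTheory

namespace RPTree

/-- The ambient Euclidean space `ℝ^D`. -/
abbrev Pt (D : ℕ) : Type := EuclideanSpace ℝ (Fin D)

section Geometry

variable {D : ℕ}

/-- For every ball `B(x, r)`, the set `B(x, r) ∩ S` is covered by `2 ^ d` balls of radius `r / 2`.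
The centres are arbitrary points of the ambient space. -/
def CoversByHalving (S : Set (Pt D)) (d : ℕ) : Prop :=
  ∀ (x : Pt D) (r : ℝ), 0 < r → ∃ T : Finset (Pt D), T.card ≤ 2 ^ d ∧
    Metric.closedBall x r ∩ S ⊆ ⋃ c ∈ T, Metric.closedBall c (r / 2)

/-- The doubling dimension of `S ⊆ ℝ^D`: the least `d` such that every `B(x, r) ∩ S` is covered by
`2 ^ d` balls of radius `r / 2`. -/
noncomputable def doublingDim (S : Set (Pt D)) : ℕ∞ :=
  ⨅ d : {d : ℕ // CoversByHalving S d}, ((d : ℕ) : ℕ∞)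

/-- The radius of a finite point set: the radius of its smallest enclosing ball. -/
noncomputable def radius (A : Finset (Pt D)) : ℝ :=
  sInf {r : ℝ | 0 ≤ r ∧ ∃ x : Pt D, (A : Set (Pt D)) ⊆ Metric.closedBall x r}

/-- The `k`-th smallest (counting from `0`, with multiplicity) of the values `f z`, `z ∈ A`. -/
noncomputable def orderStat (A : Finset (Pt D)) (f : Pt D → ℝ) (k : ℕ) : ℝ :=
  sInf {t : ℝ | k < (A.filter fun z => f z ≤ t).card}

/-- The median of the values `f z`, `z ∈ A`: the middle value if the number of values is odd, the
mean of the two middle values if it is even. -/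
noncomputable def median (A : Finset (Pt D)) (f : Pt D → ℝ) : ℝ :=
  (orderStat A f ((A.card - 1) / 2) + orderStat A f (A.card / 2)) / 2

/-- The largest distance from `x` to a point of `A` (`0` if `A` is empty). -/
noncomputable def maxDist (A : Finset (Pt D)) (x : Pt D) : ℝ :=
  ⨆ y : {y : Pt D // y ∈ A}, dist x y

end Geometry

section Randomness

/-- The random choices made in one split: a direction `v`, and a number `u` in `[-1, 1]` which gives
the offset `δ = u * 6 * Δ' / √D`. -/
abbrev Split (D : ℕ) : Type := Pt D × ℝ

/-- A node of the infinite binary tree, as the list of turns that lead to it from the root, the most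
recent turn first (`true` is a turn to the left). The descendants of `w` that lie `k` levels below
`w` are the nodes `u ++ w` with `u.length = k`. -/
abbrev Node : Type := List Bool

/-- The uniform distribution on the unit sphere of `ℝ^D`, as the law of a normalized standard
Gaussian vector. -/
noncomputable def directionLaw (D : ℕ) : Measure (Pt D) :=
  (stdGaussian (Pt D)).map fun g => ‖g‖⁻¹ • g

instance (D : ℕ) : IsProbabilityMeasure (directionLaw D) :=
  Measure.isProbabilityMeasure_map (by fun_prop)

/-- The uniform distribution on `[-1, 1]`. -/
noncomputable def offsetLaw : Measure ℝ := cond volume (Set.Icc (-1 : ℝ) 1)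

instance : IsProbabilityMeasure offsetLaw :=
  cond_isProbabilityMeasure_of_finite (by simp) (by simp)

/-- The law of one split: direction and offset are independent. -/
noncomputable def splitLaw (D : ℕ) : Measure (Split D) := (directionLaw D).prod offsetLaw

instance (D : ℕ) : IsProbabilityMeasure (splitLaw D) := by
  unfold splitLaw; infer_instance

/-- The law of the randomization of the whole tree: independent splits at all nodes. -/
noncomputable def treeLaw (D : ℕ) : Measure (Node → Split D) :=
  Measure.infinitePi fun _ => splitLaw D

instance (D : ℕ) : IsProbabilityMeasure (treeLaw D) := by
  unfold treeLaw; infer_instance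

end Randomness

section Tree

variable {D : ℕ}

/-- The splitting rule for a cell with data `A`, in which the data point `p` was picked: `x` goes to
the left child iff `x · v < median {z · v : z ∈ A} + δ`, where `δ = u * 6 * Δ' / √D` and `Δ'` is the
largest distance from `p` to a point of `A`. -/
def GoesLeft (A : Finset (Pt D)) (p : Pt D) (σ : Split D) (x : Pt D) : Prop :=
  inner ℝ x σ.1 < median A (fun z => inner ℝ z σ.1) + σ.2 * (6 * maxDist A p / Real.sqrt D)

open Classical in
/-- The data points of a cell with data `A` that go to its left (`turn = true`) or right
(`turn = false`) child, when the data point `p` was picked and the random choices are `σ`. -/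
noncomputable def childData (A : Finset (Pt D)) (p : Pt D) (σ : Split D) (turn : Bool) :
    Finset (Pt D) :=
  A.filter fun x => GoesLeft A p σ x ↔ turn = true

/-- The data points of `S` in the cell at a node of the RPTree-Max built from `S`. The point picked
at the node `w` with data `A` is `pick w A`, and `ω w` are the random choices in the split at `w`. -/
noncomputable def cellData (S : Finset (Pt D)) (pick : Node → Finset (Pt D) → Pt D)
    (ω : Node → Split D) : Node → Finset (Pt D)
  | [] => S
  | turn :: w =>
    childData (cellData S pick ω w) (pick w (cellData S pick ω w)) (ω w) turn

/-- The choices `ω₀` outside the subtree rooted at `w`, and the choices `ω` inside it. -/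
def rerandomize (w : Node) (ω₀ ω : Node → Split D) : Node → Split D :=
  fun n => if w <:+ n then ω n else ω₀ n

end Tree

end RPTree

namespace RPTree

open scoped Nat

/-! Bounding the diameter of every cell suffices, since a cell lies in a ball around any of its
points whose radius is its diameter. Let `Δ` be the radius of the starting cell. Cover its data by a
net `T` of balls of radius `r`, a small multiple of `Δ / (d * s)`. A cell of diameter above `ρ`
meets two net balls whose centres are at least `ρ - 2 * r` apart, so it is enough to destroy all
such incidences.

One split (`integral_meetsBoth_childData_le`). Suppose a cell meets two small balls at mutual
distance at least `δ`, and let `Λ` bound the distances from the picked point. The threshold is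
spread over a window of width of order `Λ / √D` around the median. The projections of a point of
each ball typically differ by order `δ / √D` and lie in this window, so the threshold separates them
with probability of order `δ / Λ`. A cell is duplicated only if a ball is cut. By chaining over nets
(`exists_projection_diam_bound`) a ball of radius `r` has expected projected width of order `r * √(d
/ D)`, so for `r` well below `δ / d` the cutting probability is dominated. Hence the expected number
of children that meet both balls is at most `1 - δ / (96 * Λ)`.

Iteration. Summed over pairs, this contracts the expected number of incidences in a level by a fixed
factor. Using only the scale `ρ = Δ / s` would give a rate of order `1 / s`, against order `d * log
(d * s)` for the logarithm of the number of pairs, and so a spurious `log s`. The potential of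
`integral_potential_childData_le` therefore adds the pairs at scale `Δ / √s` with weight `|T| ^ 2`,
and contracts at rate of order `1 / √s`. Since `√s * log s` is at most of order `s`, depth of order
`s * d * log d` is enough for Markov's inequality (`treeLaw_real_exists_cellData_le`). -/

/-! ### Moments of the projection onto a uniform random direction. -/

/-- The even moments of the standard Gaussian distribution on the line. -/
lemma integral_pow_two_mul_gaussianReal (n : ℕ) :
    ∫ x, x ^ (2 * n) ∂(gaussianReal 0 1) = ((2 * n - 1)‼ : ℕ) := by
  rw [integral_gaussianReal_eq_integral_smul one_ne_zero]
  have h1 : ∀ x : ℝ, gaussianPDFReal 0 1 x • x ^ (2 * n) =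
      (fun y : ℝ => (√(2 * Real.pi))⁻¹ * (y ^ ((2 * n : ℕ) : ℝ) *
        Real.exp (-(1 / 2) * y ^ (2 : ℝ)))) |x| := by
    intro x
    simp only [gaussianPDFReal, smul_eq_mul, Real.rpow_natCast, Real.rpow_two, sq_abs, sub_zero,
      NNReal.coe_one, mul_one]
    rw [pow_mul |x|, sq_abs, ← pow_mul]
    ring_nf
  simp_rw [h1]
  rw [integral_comp_abs (f := fun y : ℝ => (√(2 * Real.pi))⁻¹ * (y ^ ((2 * n : ℕ) : ℝ) *
        Real.exp (-(1 / 2) * y ^ (2 : ℝ)))), integral_const_mul,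
    integral_rpow_mul_exp_neg_mul_rpow (by norm_num)
      (lt_of_lt_of_le (by norm_num) (Nat.cast_nonneg (2 * n))) (by norm_num)]
  have h2 : (((2 * n : ℕ) : ℝ) + 1) / 2 = n + 1 / 2 := by push_cast; ring
  rw [neg_div, h2, Real.Gamma_nat_add_half, show (1 / 2 : ℝ) = 2⁻¹ from one_div 2, Real.inv_rpow (by norm_num), Real.rpow_neg (by norm_num),
    inv_inv, Real.rpow_add (by norm_num), Real.rpow_natCast, show (2 : ℝ) ^ (2⁻¹ : ℝ) = √2 by rw [Real.sqrt_eq_rpow, one_div],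
    Real.sqrt_mul (by norm_num)]
  have : √Real.pi ≠ 0 := by positivity
  field_simp

variable {D : ℕ}

lemma measurable_normalize : Measurable fun g : Pt D => ‖g‖⁻¹ • g := by fun_prop

lemma norm_le_one_of_directionLaw : ∀ᵐ v ∂directionLaw D, ‖v‖ ≤ 1 := by
  rw [directionLaw, ae_map_iff measurable_normalize.aemeasurable
    (measurableSet_le (by fun_prop) (by fun_prop))]
  refine .of_forall fun g => ?_
  rw [norm_smul, norm_inv, norm_norm]
  exact inv_mul_le_one

lemma map_inner_stdGaussian (z : Pt D) (hz : ‖z‖ = 1) :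
    (stdGaussian (Pt D)).map (fun g => inner ℝ z g) = gaussianReal 0 1 := by
  have h := IsGaussian.map_eq_gaussianReal (μ := stdGaussian (Pt D)) (innerSL ℝ z)
  rw [integral_strongDual_stdGaussian, variance_dual_stdGaussian] at h
  simpa [hz] using h

lemma integral_inner_pow_stdGaussian (z : Pt D) (n : ℕ) :
    ∫ g, (inner ℝ z g) ^ (2 * n) ∂(stdGaussian (Pt D)) = ‖z‖ ^ (2 * n) * ((2 * n - 1)‼ : ℕ) := by
  rcases eq_or_ne z 0 with rfl | hz
  · rcases Nat.eq_zero_or_pos n with rfl | hn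
    · simp
    · simp [hn.ne']
  · have hz' : ‖z‖ ≠ 0 := norm_ne_zero_iff.mpr hz
    have h1 : ∀ g : Pt D, (inner ℝ z g : ℝ) ^ (2 * n) =
        ‖z‖ ^ (2 * n) * (inner ℝ (‖z‖⁻¹ • z) g) ^ (2 * n) := by
      intro g
      rw [← mul_pow, inner_smul_left]
      simp [hz']
    simp_rw [h1]
    rw [integral_const_mul, ← integral_pow_two_mul_gaussianReal,
      ← map_inner_stdGaussian (‖z‖⁻¹ • z) (by simp [norm_smul, hz']),
      integral_map (by fun_prop) (by fun_prop)]

lemma integrable_norm_pow_stdGaussian (n : ℕ) :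
    Integrable (fun g : Pt D => ‖g‖ ^ n) (stdGaussian (Pt D)) := by
  have h := (IsGaussian.memLp_id (stdGaussian (Pt D)) n (by simp))
  exact h.integrable_norm_pow'

lemma integral_norm_sq_stdGaussian :
    ∫ g : Pt D, ‖g‖ ^ 2 ∂(stdGaussian (Pt D)) = D := by
  have h1 : ∀ g : Pt D, ‖g‖ ^ 2 = ∑ i, (inner ℝ (EuclideanSpace.basisFun (Fin D) ℝ i) g) ^ (2 * 1) := by
    intro g
    rw [mul_one]
    exact ((EuclideanSpace.basisFun (Fin D) ℝ).sum_sq_inner_right g).symm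
  simp_rw [h1]
  rw [integral_finsetSum]
  · simp_rw [integral_inner_pow_stdGaussian]
    simp
  · intro i _
    refine (integrable_norm_pow_stdGaussian 2).mono' (by fun_prop) (.of_forall fun g => ?_)
    rw [mul_one, norm_pow, Real.norm_eq_abs]
    gcongr
    simpa using abs_real_inner_le_norm (EuclideanSpace.basisFun (Fin D) ℝ i) g

/-- This is Jensen's inequality for `t ↦ t ^ n`, obtained by integrating Bernoulli's inequality (the
tangent line) at `‖g‖ ^ 2 / D`, which has mean `1`. -/
lemma pow_le_integral_norm_pow_stdGaussian (n : ℕ) :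
    (D : ℝ) ^ n ≤ ∫ g : Pt D, ‖g‖ ^ (2 * n) ∂(stdGaussian (Pt D)) := by
  rcases Nat.eq_zero_or_pos D with rfl | hD
  · rcases Nat.eq_zero_or_pos n with rfl | hn
    · simp
    · rw [Nat.cast_zero, zero_pow hn.ne']
      exact integral_nonneg fun g => by positivity
  have hD' : (0 : ℝ) < D := by exact_mod_cast hD
  have h1 : ∀ g : Pt D, (D : ℝ) ^ n + n * (D : ℝ) ^ n * (‖g‖ ^ 2 / D - 1) ≤ ‖g‖ ^ (2 * n) := by
    intro g
    have h := one_add_mul_le_pow (a := ‖g‖ ^ 2 / D - 1)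
      (by have : 0 ≤ ‖g‖ ^ 2 / D := by positivity
          linarith) n
    have h2 := mul_le_mul_of_nonneg_left h (pow_nonneg hD'.le n)
    rw [add_sub_cancel, div_pow, mul_div_cancel₀ _ (by positivity), ← pow_mul] at h2
    linarith
  have i2 := integrable_norm_pow_stdGaussian (D := D) 2
  calc (D : ℝ) ^ n = ∫ g : Pt D, ((D : ℝ) ^ n + n * (D : ℝ) ^ n * (‖g‖ ^ 2 / D - 1))
        ∂(stdGaussian (Pt D)) := by
        have i3 : Integrable (fun g : Pt D => ‖g‖ ^ 2 / (D : ℝ) - 1) (stdGaussian (Pt D)) :=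
          (i2.div_const _).sub (integrable_const 1)
        rw [integral_add (integrable_const _) (i3.const_mul _),
          integral_const_mul, integral_sub (i2.div_const _) (integrable_const 1), integral_div,
          integral_norm_sq_stdGaussian]
        simp [hD'.ne']
    _ ≤ _ := integral_mono (by
          exact (integrable_const _).add (((i2.div_const _).sub (by fun_prop)).const_mul _))
          (integrable_norm_pow_stdGaussian _) h1

lemma map_directionLaw (e : Pt D ≃ₗᵢ[ℝ] Pt D) : (directionLaw D).map e = directionLaw D := by
  conv_rhs => rw [directionLaw, ← stdGaussian_map e]
  rw [directionLaw, Measure.map_map (by fun_prop) measurable_normalize,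
    Measure.map_map measurable_normalize (by fun_prop)]
  congr 1
  ext1 g
  simp

lemma integral_inner_pow_directionLaw_eq_of_norm_eq {z z' : Pt D} (h : ‖z‖ = ‖z'‖) (n : ℕ) :
    ∫ v, (inner ℝ z v) ^ n ∂(directionLaw D) = ∫ v, (inner ℝ z' v) ^ n ∂(directionLaw D) := by
  let e : Pt D ≃ₗᵢ[ℝ] Pt D := (ℝ ∙ (z - z'))ᗮ.reflection
  have he : e z = z' := Submodule.reflection_sub h
  conv_rhs => rw [← map_directionLaw e, integral_map (by fun_prop) (by fun_prop), ← he]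
  simp

lemma integrable_inner_pow_directionLaw (z : Pt D) (n : ℕ) :
    Integrable (fun v => (inner ℝ z v : ℝ) ^ n) (directionLaw D) := by
  refine (integrable_const (‖z‖ ^ n)).mono' (by fun_prop) ?_
  filter_upwards [norm_le_one_of_directionLaw] with v hv
  rw [norm_pow, Real.norm_eq_abs]
  gcongr
  calc |inner ℝ z v| ≤ ‖z‖ * ‖v‖ := abs_real_inner_le_norm z v
    _ ≤ ‖z‖ * 1 := by gcongr
    _ = ‖z‖ := mul_one _

lemma norm_eq_one_of_directionLaw (hD : 0 < D) : ∀ᵐ v ∂directionLaw D, ‖v‖ = 1 := by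
  rw [directionLaw, ae_map_iff measurable_normalize.aemeasurable
    (measurableSet_eq_fun (by fun_prop) (by fun_prop))]
  let z : Pt D := EuclideanSpace.basisFun (Fin D) ℝ ⟨0, hD⟩
  have h : ∀ᵐ g ∂stdGaussian (Pt D), (inner ℝ z g : ℝ) ≠ 0 := by
    have h1 : ∀ᵐ x : ℝ ∂(gaussianReal 0 1), x ≠ 0 := by
      have : NullSingletonClass (gaussianReal 0 1) :=
        nullSingletonClass_gaussianReal one_ne_zero
      exact Measure.ae_ne (gaussianReal 0 1) 0
    rw [← map_inner_stdGaussian z (by simp [z])] at h1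
    exact ae_of_ae_map (f := fun g => inner ℝ z g) (by fun_prop) h1
  filter_upwards [h] with g hg
  have : g ≠ 0 := by rintro rfl; simp at hg
  rw [norm_smul, norm_inv, norm_norm, inv_mul_cancel₀ (norm_ne_zero_iff.mpr this)]

/-- Pairing a random direction with an independent Gaussian vector computes the even moments of
the coordinates of the direction. -/
lemma integral_norm_pow_mul_integral_inner_pow (hD : 0 < D) (z : Pt D) (n : ℕ) :
    (∫ g : Pt D, ‖g‖ ^ (2 * n) ∂(stdGaussian (Pt D))) *
      ∫ v, (inner ℝ z v) ^ (2 * n) ∂(directionLaw D) = ‖z‖ ^ (2 * n) * ((2 * n - 1)‼ : ℕ) := by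
  let e : Pt D := EuclideanSpace.basisFun (Fin D) ℝ ⟨0, hD⟩
  have he : ‖e‖ = 1 := by simp [e]
  have hsc : ∀ y : Pt D, ∫ v, (inner ℝ y v) ^ (2 * n) ∂(directionLaw D) =
      ‖y‖ ^ (2 * n) * ∫ v, (inner ℝ e v) ^ (2 * n) ∂(directionLaw D) := by
    intro y
    rw [integral_inner_pow_directionLaw_eq_of_norm_eq (z := y) (z' := ‖y‖ • e)
      (by simp [norm_smul, he])]
    simp_rw [inner_smul_left, mul_pow]
    rw [integral_const_mul]
    simp
  rw [hsc z, mul_left_comm]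
  congr 1
  -- Evaluate the double integral of `⟪g, v⟫ ^ (2 * n)` in both orders: over `v` first it gives `‖g‖
  -- ^ (2 * n)` times the moment sought; over `g` first it is a Gaussian moment, because `‖v‖ = 1`.
  rw [← integral_mul_const]
  simp_rw [← hsc]
  rw [integral_integral_swap]
  · rw [integral_congr_ae (g := fun _ => (((2 * n - 1)‼ : ℕ) : ℝ))]
    · simp
    filter_upwards [norm_eq_one_of_directionLaw hD] with v hv
    simp_rw [real_inner_comm v]
    rw [integral_inner_pow_stdGaussian, hv]
    simp
  · have hb : Integrable (fun p : Pt D × Pt D => ‖p.1‖ ^ (2 * n) * (1 : ℝ))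
        ((stdGaussian (Pt D)).prod (directionLaw D)) :=
      (integrable_norm_pow_stdGaussian _).mul_prod (integrable_const 1)
    refine hb.mono' (by unfold Function.uncurry; fun_prop) ?_
    have h2 : ∀ᵐ p ∂(stdGaussian (Pt D)).prod (directionLaw D), ‖p.2‖ ≤ 1 :=
      Measure.quasiMeasurePreserving_snd.ae norm_le_one_of_directionLaw
    filter_upwards [h2] with p hp
    simp only [Function.uncurry, norm_pow, Real.norm_eq_abs, mul_one]
    gcongr
    calc |inner ℝ p.1 p.2| ≤ ‖p.1‖ * ‖p.2‖ := abs_real_inner_le_norm _ _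
      _ ≤ ‖p.1‖ * 1 := by gcongr
      _ = ‖p.1‖ := mul_one _

lemma integral_inner_pow_directionLaw_le (hD : 0 < D) (z : Pt D) (n : ℕ) :
    ∫ v, (inner ℝ z v) ^ (2 * n) ∂(directionLaw D) ≤
      ‖z‖ ^ (2 * n) * ((2 * n - 1)‼ : ℕ) / D ^ n := by
  rw [← integral_norm_pow_mul_integral_inner_pow hD z n, le_div_iff₀ (by positivity), mul_comm]
  gcongr
  · exact integral_nonneg fun v => (even_two_mul n).pow_nonneg _
  · exact pow_le_integral_norm_pow_stdGaussian n

lemma integral_inner_sq_directionLaw (hD : 0 < D) (z : Pt D) :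
    ∫ v, (inner ℝ z v) ^ 2 ∂(directionLaw D) = ‖z‖ ^ 2 / D := by
  have h := integral_norm_pow_mul_integral_inner_pow hD z 1
  simp only [mul_one, integral_norm_sq_stdGaussian] at h
  rw [eq_div_iff (by positivity), mul_comm, h]
  simp

/-! ### Chaining: projected width of a ball in a doubling set. -/

lemma CoversByHalving.exists_net {D : ℕ} {S : Set (Pt D)} {d : ℕ} (h : CoversByHalving S d)
    (x : Pt D) {r : ℝ} (hr : 0 < r) (m : ℕ) :
    ∃ T : Finset (Pt D), T.card ≤ 2 ^ (d * m) ∧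
      ∀ z ∈ S, dist z x ≤ r → ∃ c ∈ T, dist z c ≤ r / 2 ^ m := by
  classical
  induction m with
  | zero => exact ⟨{x}, by simp, fun z _ hz => ⟨x, by simp, by simpa using hz⟩⟩
  | succ m ih =>
    obtain ⟨T, hT, hTc⟩ := ih
    choose U hU hUc using fun c => h c (r / 2 ^ m) (by positivity)
    refine ⟨T.biUnion U, ?_, fun z hz hzx => ?_⟩
    · calc (T.biUnion U).card ≤ T.card * 2 ^ d := Finset.card_biUnion_le_card_mul _ _ _ fun c _ => hU c
        _ ≤ 2 ^ (d * m) * 2 ^ d := by gcongr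
        _ = 2 ^ (d * (m + 1)) := by rw [← pow_add]; ring_nf
    · obtain ⟨c, hc, hzc⟩ := hTc z hz hzx
      have := hUc c ⟨Metric.mem_closedBall.mpr hzc, hz⟩
      simp only [Set.mem_iUnion, Metric.mem_closedBall] at this
      obtain ⟨c', hc', hzc'⟩ := this
      refine ⟨c', Finset.mem_biUnion.mpr ⟨c, hc, hc'⟩, hzc'.trans (le_of_eq ?_)⟩
      rw [pow_succ]
      field_simp

lemma doubleFactorial_two_mul_sub_one_le (n : ℕ) : (2 * n - 1)‼ ≤ (2 * n) ^ n := by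
  induction n with
  | zero => simp
  | succ n ih =>
    rw [show 2 * (n + 1) - 1 = 2 * n + 1 by omega, Nat.doubleFactorial_add_one, pow_succ']
    gcongr
    · omega
    · exact ih.trans (by gcongr; omega)

/-- Replaces the expected maximum of a family by `ε` plus `ε` times a sum of normalized `q`-th
moments. -/
lemma le_add_mul_div_pow {t ε : ℝ} (ht : 0 ≤ t) (hε : 0 < ε) {q : ℕ} (hq : q ≠ 0) :
    t ≤ ε + ε * (t / ε) ^ q := by
  rcases le_total t ε with h | h
  · exact h.trans (le_add_of_nonneg_right (by positivity))
  · have h1 : 1 ≤ t / ε := (one_le_div hε).mpr h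
    calc t = ε * (t / ε) := by field_simp
      _ ≤ ε * (t / ε) ^ q := by gcongr; exact le_self_pow₀ h1 hq
      _ ≤ _ := by linarith

lemma sum_three_quarters_pow_le (L : ℕ) : ∑ m ∈ Finset.range L, (3 / 4 : ℝ) ^ m ≤ 4 := by
  rw [geom_sum_eq (by norm_num)]
  have : (0 : ℝ) ≤ (3 / 4) ^ L := by positivity
  norm_num
  linarith

/-- Expected size of a family of short differences, one dyadic level of the chaining bound. -/
lemma integral_sum_inner_pow_le {D : ℕ} (hD : 0 < D) {n : ℕ} {a ε : ℝ} (ha : 0 ≤ a) (hε : 0 < ε)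
    (Λ : Finset (Pt D × Pt D)) (hΛ : ∀ l ∈ Λ, dist l.1 l.2 ≤ a) :
    ∫ v, ∑ l ∈ Λ, (inner ℝ (l.1 - l.2) v / ε) ^ (2 * n) ∂(directionLaw D) ≤
      Λ.card * (a * √(2 * n) / √D / ε) ^ (2 * n) := by
  rw [integral_finsetSum]
  · rw [← nsmul_eq_mul]
    refine Finset.sum_le_card_nsmul _ _ _ fun l hl => ?_
    simp_rw [div_pow]
    rw [integral_div]
    gcongr
    refine (integral_inner_pow_directionLaw_le hD _ _).trans ?_
    rw [← dist_eq_norm]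
    have h1 : (((2 * n - 1)‼ : ℕ) : ℝ) ≤ (√(2 * n)) ^ (2 * n) := by
      rw [pow_mul, Real.sq_sqrt (by positivity)]
      exact_mod_cast doubleFactorial_two_mul_sub_one_le n
    have h2 : √(D : ℝ) ^ (2 * n) = (D : ℝ) ^ n := by
      rw [pow_mul, Real.sq_sqrt (by positivity)]
    rw [mul_pow, h2]
    gcongr
    exact hΛ l hl
  · intro l _
    simp_rw [div_pow]
    exact (integrable_inner_pow_directionLaw _ _).div_const _

/-- There are at most `2 ^ (d * (2 * m + 1))` links at level `m`, and `4 * d`-th moments beat this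
count because `4 * (2 / 3) ^ 4 = 64 / 81 < 1`. -/
lemma level_count_mul_le_one (d m : ℕ) :
    ((2 ^ (d * m) * 2 ^ (d * (m + 1)) : ℕ) : ℝ) *
      (1 / 2 * (2 / 3) ^ m) ^ (2 * (2 * d)) ≤ 1 := by
  have : ((2 ^ (d * m) * 2 ^ (d * (m + 1)) : ℕ) : ℝ) * (1 / 2 * (2 / 3) ^ m) ^ (2 * (2 * d)) =
      ((1 / 8) * (64 / 81 : ℝ) ^ m) ^ d := by
    have e1 : (64 / 81 : ℝ) = 2 * 2 * (2 / 3) ^ 4 := by norm_num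
    have e2 : (1 / 8 : ℝ) = 2 * (1 / 2) ^ 4 := by norm_num
    rw [e1, e2]
    push_cast
    simp only [mul_pow, ← pow_mul]
    ring_nf
  rw [this]
  refine pow_le_one₀ (by positivity) ?_
  have : (64 / 81 : ℝ) ^ m ≤ 1 := pow_le_one₀ (by norm_num) (by norm_num)
  linarith

/-- Simultaneous bound, small on average, for the projections of all short differences between two
consecutive nets of a set of doubling dimension `d`. -/
lemma exists_level_bound {D : ℕ} (hD : 0 < D) {d m : ℕ} (hd : 1 ≤ d) {r : ℝ} (hr : 0 < r)
    {T T' : Finset (Pt D)} (hT : T.card ≤ 2 ^ (d * m)) (hT' : T'.card ≤ 2 ^ (d * (m + 1))) :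
    ∃ F : Pt D → ℝ, Integrable F (directionLaw D) ∧
      (∀ c ∈ T, ∀ c' ∈ T', dist c c' ≤ 2 * (r / 2 ^ m) → ∀ v, |inner ℝ (c - c') v| ≤ F v) ∧
      ∫ v, F v ∂(directionLaw D) ≤ 16 * (r * √d / √D) * (3 / 4) ^ m := by
  classical
  set b : ℝ := 4 * r * √d / √D with hb
  have hd' : (1 : ℝ) ≤ d := by exact_mod_cast hd
  have hb0 : 0 < b := by positivity
  -- Link lengths decay like `2 ^ (-m)`. The slower rate `3 / 4` is still summable and leaves a
  -- factor `(2 / 3) ^ m` in the normalized moments to pay for the growing number of links.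
  obtain ⟨ε, hεdef⟩ : ∃ ε : ℝ, ε = 2 * b * (3 / 4) ^ m := ⟨_, rfl⟩
  have hε : 0 < ε := by rw [hεdef]; positivity
  let Λ : Finset (Pt D × Pt D) := (T ×ˢ T').filter fun l => dist l.1 l.2 ≤ 2 * (r / 2 ^ m)
  have hΛcard : (Λ.card : ℝ) ≤ ((2 ^ (d * m) * 2 ^ (d * (m + 1)) : ℕ) : ℝ) := by
    norm_cast
    refine (Finset.card_filter_le _ _).trans ?_
    rw [Finset.card_product]
    exact Nat.mul_le_mul hT hT'
  let G : Pt D → ℝ := fun v => ∑ l ∈ Λ, ((inner ℝ (l.1 - l.2) v : ℝ) / ε) ^ (2 * (2 * d))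
  have hG : Integrable G (directionLaw D) := by
    refine integrable_finsetSum _ fun l _ => ?_
    simp_rw [div_pow]
    exact (integrable_inner_pow_directionLaw _ _).div_const _
  have hGle : ∫ v, G v ∂(directionLaw D) ≤ 1 := by
    have h1 := integral_sum_inner_pow_le hD (n := 2 * d) (a := 2 * (r / 2 ^ m)) (by positivity)
      hε Λ (fun l hl => (Finset.mem_filter.mp hl).2)
    have h2 : 2 * (r / 2 ^ m) * √(2 * ((2 * d : ℕ) : ℝ)) / √D / ε = 1 / 2 * (2 / 3) ^ m := by
      have e1 : √(2 * ((2 * d : ℕ) : ℝ)) = 2 * √d := by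
        rw [show (2 * ((2 * d : ℕ) : ℝ)) = 2 ^ 2 * d by push_cast; ring,
          Real.sqrt_mul (by norm_num), Real.sqrt_sq (by norm_num)]
      have e2 : (2 / 3 : ℝ) ^ m = (1 / 2 ^ m) / (3 / 4) ^ m := by
        rw [← one_div_pow, ← div_pow]; norm_num
      have : 0 < √(d : ℝ) := by positivity
      rw [e1, e2, hεdef, hb]
      field_simp
      norm_num
    rw [h2] at h1
    exact h1.trans ((mul_le_mul_of_nonneg_right hΛcard (by positivity)).trans
        (level_count_mul_le_one d m))
  refine ⟨fun v => ε + ε * G v, (integrable_const _).add (hG.const_mul _), ?_, ?_⟩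
  · intro c hc c' hc' hcc v
    have hm : (c, c') ∈ Λ := Finset.mem_filter.mpr ⟨Finset.mem_product.mpr ⟨hc, hc'⟩, hcc⟩
    refine (le_add_mul_div_pow (abs_nonneg _) hε (q := 2 * (2 * d)) (by omega)).trans ?_
    rw [div_pow, (even_two_mul _).pow_abs, ← div_pow]
    obtain ⟨q, hq, hqe⟩ : ∃ q, q = 2 * (2 * d) ∧ Even q := ⟨_, rfl, even_two_mul _⟩
    simp only [G, ← hq]
    have h4 := Finset.single_le_sum
      (f := fun l : Pt D × Pt D => ((inner ℝ (l.1 - l.2) v : ℝ) / ε) ^ q)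
      (fun l _ => hqe.pow_nonneg _) hm
    gcongr
  · rw [integral_add (integrable_const _) (hG.const_mul _), integral_const_mul]
    simp only [integral_const, probReal_univ, one_smul]
    calc ε + ε * ∫ v, G v ∂(directionLaw D) ≤ ε + ε * 1 := by gcongr
      _ = _ := by rw [hεdef, hb]; ring

/-- Random projections of a ball in a set of doubling dimension `d` have small diameter on
average. -/
lemma exists_projection_diam_bound {D : ℕ} (hD : 0 < D) {S : Set (Pt D)} {d : ℕ} (hd : 1 ≤ d)
    (hS : CoversByHalving S d) (x : Pt D) {r : ℝ} (hr : 0 < r) :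
    ∃ M : Pt D → ℝ, Integrable M (directionLaw D) ∧
      (∀ v : Pt D, ‖v‖ ≤ 1 → ∀ z ∈ S, dist z x ≤ r → ∀ z' ∈ S, dist z' x ≤ r →
        |inner ℝ (z - z') v| ≤ M v) ∧
      ∫ v, M v ∂(directionLaw D) ≤ 130 * r * √d / √D := by
  classical
  choose T hTcard hT using fun m => hS.exists_net x hr m
  choose F hFint hFlink hFle using fun m =>
    exists_level_bound hD (m := m) hd hr (hTcard m) (hTcard (m + 1))
  have hd' : (1 : ℝ) ≤ d := by exact_mod_cast hd
  have hD' : (1 : ℝ) ≤ D := by exact_mod_cast hD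
  have hsum : Integrable (fun v => ∑ m ∈ Finset.range D, F m v) (directionLaw D) :=
    integrable_finsetSum _ fun m _ => hFint m
  -- The chain stops at level `D`: the remainder `r / 2 ^ D` is already at most `r / √D`.
  have key : ∀ v : Pt D, ‖v‖ ≤ 1 → ∀ z ∈ S, dist z x ≤ r → ∃ c ∈ T 0, |inner ℝ (z - c) v| ≤
      ∑ m ∈ Finset.range D, F m v + r / 2 ^ D := by
    intro v hv z hz hzx
    choose c hcT hc using fun m => hT m z hz hzx
    refine ⟨c 0, hcT 0, ?_⟩
    have hlink : ∀ m, |inner ℝ (c m - c (m + 1)) v| ≤ F m v := by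
      intro m
      refine hFlink m _ (hcT m) _ (hcT (m + 1)) ?_ v
      have h1 := dist_triangle_left (c m) (c (m + 1)) z
      have h2 : r / 2 ^ (m + 1) ≤ r / 2 ^ m := by gcongr <;> simp
      linarith [hc m, hc (m + 1)]
    have htel : z - c 0 = (z - c D) - ∑ m ∈ Finset.range D, (c m - c (m + 1)) := by
      rw [Finset.sum_range_sub']
      abel
    rw [htel, inner_sub_left, sum_inner]
    refine (abs_sub _ _).trans ?_
    rw [add_comm]
    refine add_le_add ((Finset.abs_sum_le_sum_abs _ _).trans
      (Finset.sum_le_sum fun m _ => hlink m)) ?_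
    calc |inner ℝ (z - c D) v| ≤ ‖z - c D‖ * ‖v‖ := abs_real_inner_le_norm _ _
      _ ≤ r / 2 ^ D * 1 := by
        gcongr
        rw [← dist_eq_norm]
        exact hc D
      _ = _ := mul_one _
  refine ⟨fun v => 2 * (∑ m ∈ Finset.range D, F m v + r / 2 ^ D),
    (hsum.add (integrable_const _)).const_mul 2, fun v hv z hz hzx z' hz' hzx' => ?_, ?_⟩
  · obtain ⟨c, hc, h1⟩ := key v hv z hz hzx
    obtain ⟨c', hc', h2⟩ := key v hv z' hz' hzx'
    -- The net at level `0` has at most `2 ^ 0` points, so both chains have the same end.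
    have : c = c' := Finset.card_le_one.mp (by simpa using hTcard 0) _ hc _ hc'
    subst this
    rw [show z - z' = (z - c) - (z' - c) by abel, inner_sub_left]
    refine (abs_sub _ _).trans ?_
    linarith
  · rw [integral_const_mul, integral_add hsum (integrable_const _),
      integral_finsetSum _ fun m _ => hFint m]
    simp only [integral_const, probReal_univ, one_smul]
    have h1 : ∑ m ∈ Finset.range D, ∫ v, F m v ∂(directionLaw D) ≤ 64 * (r * √d / √D) := by
      calc _ ≤ ∑ m ∈ Finset.range D, 16 * (r * √d / √D) * (3 / 4) ^ m :=
            Finset.sum_le_sum fun m _ => hFle m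
        _ = 16 * (r * √d / √D) * ∑ m ∈ Finset.range D, (3 / 4 : ℝ) ^ m := by rw [Finset.mul_sum]
        _ ≤ 16 * (r * √d / √D) * 4 := by gcongr; exact sum_three_quarters_pow_le D
        _ = _ := by ring
    have h2 : r / 2 ^ D ≤ r * √d / √D := by
      have h3 : √(D : ℝ) ≤ 2 ^ D := by
        refine (Real.sqrt_le_self_iff.mpr (Or.inr hD')).trans ?_
        exact_mod_cast Nat.lt_two_pow_self.le
      have h4 : 1 ≤ √(d : ℝ) := Real.one_le_sqrt.mpr hd'
      calc r / 2 ^ D ≤ r * 1 / √D := by rw [mul_one]; gcongr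
        _ ≤ _ := by gcongr
    calc 2 * (∑ m ∈ Finset.range D, ∫ v, F m v ∂(directionLaw D) + r / 2 ^ D)
        ≤ 2 * (64 * (r * √d / √D) + r * √d / √D) := by gcongr
      _ = _ := by ring

/-! ### Order statistics and the median. -/

section Median

variable {A : Finset (Pt D)} {f : Pt D → ℝ} {k : ℕ}

/-- Turns order statistics into counts, which yields both monotonicity and measurability. The bound
on `k` keeps the infimum from being over the empty set. -/
lemma orderStat_lt_iff (hk : k < A.card) {t : ℝ} :
    orderStat A f k < t ↔ k < (A.filter fun z => f z < t).card := by
  classical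
  have hA : A.Nonempty := Finset.card_pos.mp (by omega)
  have hne : {t : ℝ | k < (A.filter fun z => f z ≤ t).card}.Nonempty := by
    refine ⟨A.sup' hA f, ?_⟩
    rw [Set.mem_ofPred_eq, Finset.filter_true_of_mem fun z hz => Finset.le_sup' f hz]
    exact hk
  have hbdd : BddBelow {t : ℝ | k < (A.filter fun z => f z ≤ t).card} := by
    refine ⟨A.inf' hA f, fun t ht => ?_⟩
    obtain ⟨z, hz⟩ := Finset.card_pos.mp ((Nat.zero_le k).trans_lt ht)
    rw [Finset.mem_filter] at hz
    exact (Finset.inf'_le f hz.1).trans hz.2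
  rw [orderStat, csInf_lt_iff hbdd hne]
  constructor
  · rintro ⟨s, hs, hst⟩
    refine lt_of_lt_of_le hs (Finset.card_le_card ?_)
    exact Finset.monotone_filter_right _ fun z _ hz => lt_of_le_of_lt hz hst
  · intro h
    have hB : (A.filter fun z => f z < t).Nonempty := Finset.card_pos.mp (by omega)
    refine ⟨(A.filter fun z => f z < t).sup' hB f, ?_, ?_⟩
    · refine lt_of_lt_of_le h (Finset.card_le_card fun z hz => ?_)
      exact Finset.mem_filter.mpr ⟨(Finset.mem_filter.mp hz).1, Finset.le_sup' f hz⟩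
    · rw [Finset.sup'_lt_iff]
      exact fun z hz => (Finset.mem_filter.mp hz).2

lemma orderStat_eq_zero (hk : A.card ≤ k) : orderStat A f k = 0 := by
  have : {t : ℝ | k < (A.filter fun z => f z ≤ t).card} = ∅ := by
    ext t
    simpa using (Finset.card_filter_le A _).trans hk
  rw [orderStat, this, Real.sInf_empty]

lemma orderStat_mono {l : ℕ} (hkl : k ≤ l) (hl : l < A.card) :
    orderStat A f k ≤ orderStat A f l := by
  refine le_of_forall_gt fun t ht => ?_
  rw [orderStat_lt_iff hl] at ht
  rw [orderStat_lt_iff (hkl.trans_lt hl)]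
  omega

/-- If the median is far from `c`, then so are at least half of the values. -/
lemma card_le_two_mul_card_of_lt_abs_median_sub (hA : A.Nonempty) {c h : ℝ}
    (hm : h < |median A f - c|) :
    A.card ≤ 2 * (A.filter fun z => h ≤ |f z - c|).card := by
  classical
  have hpos := hA.card_pos
  have hmono := orderStat_mono (f := f) (k := (A.card - 1) / 2) (l := A.card / 2)
    (A := A) (by omega) (by omega)
  rcases lt_abs.mp hm with h1 | h1
  -- The median is a mean, so the upper middle value is at least as large as it; below, the lower
  -- middle value is used in the same way.
  · have h2 : c + h < orderStat A f (A.card / 2) := by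
      rw [median] at h1; linarith
    have h3 := mt (orderStat_lt_iff (f := f) (t := c + h) (k := A.card / 2) (by omega)).mpr
      (not_lt.mpr h2.le)
    have h4 := Finset.card_filter_add_card_filter_not (s := A) (fun z => f z < c + h)
    have h5 : (A.filter fun z => ¬ f z < c + h).card ≤
        (A.filter fun z => h ≤ |f z - c|).card := by
      refine Finset.card_le_card (Finset.monotone_filter_right _ fun z _ hz => ?_)
      exact le_abs.mpr (Or.inl (by linarith [not_lt.mp hz]))
    omega
  · have h2 : orderStat A f ((A.card - 1) / 2) < c - h := by
      rw [median] at h1; linarith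
    rw [orderStat_lt_iff (by omega)] at h2
    have h5 : (A.filter fun z => f z < c - h).card ≤
        (A.filter fun z => h ≤ |f z - c|).card := by
      refine Finset.card_le_card (Finset.monotone_filter_right _ fun z _ hz => ?_)
      exact le_abs.mpr (Or.inr (by linarith))
    omega

lemma measurable_orderStat {Ω : Type*} [MeasurableSpace Ω] (A : Finset (Pt D)) {F : Ω → Pt D → ℝ}
    (hF : ∀ z ∈ A, Measurable fun ω => F ω z) (k : ℕ) :
    Measurable fun ω => orderStat A (F ω) k := by
  classical
  rcases le_or_gt A.card k with hk | hk
  · simp_rw [orderStat_eq_zero hk]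
    exact measurable_const
  refine measurable_of_Iio fun t => ?_
  have h1 : (fun ω => orderStat A (F ω) k) ⁻¹' Set.Iio t =
      (fun ω => ∑ z ∈ A, if F ω z < t then 1 else 0) ⁻¹' Set.Ioi k := by
    ext ω
    simp only [Set.mem_preimage, Set.mem_Iio, Set.mem_Ioi, orderStat_lt_iff hk, Finset.card_filter]
  rw [h1]
  refine (Finset.measurable_sum _ fun z hz => ?_) measurableSet_Ioi
  exact Measurable.ite (measurableSet_lt (hF z hz) measurable_const) measurable_const
    measurable_const

lemma measurable_median {Ω : Type*} [MeasurableSpace Ω] (A : Finset (Pt D)) {F : Ω → Pt D → ℝ}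
    (hF : ∀ z ∈ A, Measurable fun ω => F ω z) :
    Measurable fun ω => median A (F ω) :=
  ((measurable_orderStat A hF _).add (measurable_orderStat A hF _)).div_const _

end Median

/-! ### Measurability of the random children. -/

section Measurability

lemma measurableSet_goesLeft (A : Finset (Pt D)) (p x : Pt D) :
    MeasurableSet {σ : Split D | GoesLeft A p σ x} := by
  refine measurableSet_lt (by fun_prop) (Measurable.add ?_ (by fun_prop))
  exact measurable_median A fun z _ => by fun_prop

/-- A random subset of a finite set is measurable, for the discrete σ-algebra, as soon as all
membership events are. -/
lemma measurableSet_preimage_of_subset {Ω : Type*} [MeasurableSpace Ω] {A : Finset (Pt D)}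
    {F : Ω → Finset (Pt D)} (hFA : ∀ ω, F ω ⊆ A) (hF : ∀ x ∈ A, MeasurableSet {ω | x ∈ F ω})
    (s : Set (Finset (Pt D))) : MeasurableSet (F ⁻¹' s) := by
  classical
  have h1 : F ⁻¹' s = ⋃ B ∈ A.powerset.filter (· ∈ s), ⋂ x ∈ A, {ω | x ∈ F ω ↔ x ∈ B} := by
    ext ω
    simp only [Set.mem_preimage, Finset.mem_filter, Finset.mem_powerset, Set.mem_iUnion,
      Set.mem_iInter, Set.mem_ofPred_eq, exists_prop]
    constructor
    · intro h
      exact ⟨F ω, ⟨hFA ω, h⟩, fun x _ => Iff.rfl⟩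
    · rintro ⟨B, ⟨hBA, hB⟩, h⟩
      have : F ω = B := by
        ext x
        by_cases hx : x ∈ A
        · exact h x hx
        · exact iff_of_false (fun h' => hx (hFA ω h')) fun h' => hx (hBA h')
      rwa [this]
  rw [h1]
  refine Finset.measurableSet_biUnion _ fun B _ => Finset.measurableSet_biInter _ fun x hx => ?_
  exact (hF x hx).iff (MeasurableSet.const _)

lemma childData_subset (A : Finset (Pt D)) (p : Pt D) (σ : Split D) (t : Bool) :
    childData A p σ t ⊆ A := by
  classical
  exact Finset.filter_subset _ _

lemma mem_childData {A : Finset (Pt D)} {p : Pt D} {σ : Split D} {t : Bool} {x : Pt D} :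
    x ∈ childData A p σ t ↔ x ∈ A ∧ (GoesLeft A p σ x ↔ t = true) := by
  classical
  simp [childData]

lemma measurableSet_childData (A : Finset (Pt D)) (p : Pt D) (t : Bool)
    (s : Set (Finset (Pt D))) : MeasurableSet {σ : Split D | childData A p σ t ∈ s} := by
  refine measurableSet_preimage_of_subset (F := fun σ => childData A p σ t)
    (fun σ => childData_subset A p σ t) (fun x hx => ?_) s
  simp_rw [mem_childData]
  exact (MeasurableSet.const _).inter ((measurableSet_goesLeft A p x).iff (MeasurableSet.const _))

end Measurability

/-! ### The effect of one split on a pair of small balls. -/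

/-- Bounds a first absolute moment below by second and fourth moments, which are available. The two
sides touch at `|T| = 5 / 3`: their difference is `|T|` times `(|T| - 5 / 3) ^ 2` times a positive
linear factor. -/
lemma abs_lower_bound (T : ℝ) : 9 / 10 * T ^ 2 - 27 / 250 * T ^ 4 ≤ |T| := by
  have h0 := abs_nonneg T
  have h : T ^ 2 = |T| ^ 2 := (sq_abs T).symm
  have h' : T ^ 4 = |T| ^ 4 := by rw [show T ^ 4 = (T ^ 2) ^ 2 by ring, h]; ring
  rw [h, h']
  have : 0 ≤ |T| * ((|T| - 5 / 3) ^ 2 * (27 / 250 * (|T| + 10 / 3))) := by positivity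
  nlinarith

section Offset

lemma offsetLaw_real_apply (s : Set ℝ) :
    offsetLaw.real s = volume.real (Set.Icc (-1 : ℝ) 1 ∩ s) / 2 := by
  rw [offsetLaw, measureReal_def, cond_apply measurableSet_Icc, ENNReal.toReal_mul,
    ENNReal.toReal_inv, Real.volume_Icc, ← measureReal_def, ENNReal.toReal_ofReal (by norm_num)]
  norm_num
  ring

lemma offsetLaw_real_near_le {m h c M : ℝ} (hh : 0 < h) (hM : 0 ≤ M) :
    offsetLaw.real {u | |m + u * h - c| ≤ M} ≤ M / h := by
  have h1 : {u | |m + u * h - c| ≤ M} = Set.Icc ((c - m - M) / h) ((c - m + M) / h) := by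
    ext u
    simp only [Set.mem_ofPred_eq, Set.mem_Icc, abs_le, div_le_iff₀ hh, le_div_iff₀ hh]
    constructor <;> rintro ⟨h1, h2⟩ <;> constructor <;> linarith
  rw [h1, offsetLaw_real_apply, div_le_iff₀ two_pos]
  refine (measureReal_mono Set.inter_subset_right (by simp)).trans ?_
  rw [Real.volume_real_Icc_of_le (by gcongr; linarith), ← sub_div]
  exact le_of_eq (by ring)

lemma offsetLaw_real_between {m h a b : ℝ} (hh : 0 < h) (hab : a ≤ b) (ha : m - h ≤ a)
    (hb : b ≤ m + h) :
    offsetLaw.real {u | a < m + u * h ∧ m + u * h ≤ b} = (b - a) / (2 * h) := by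
  have h1 : {u | a < m + u * h ∧ m + u * h ≤ b} = Set.Ioc ((a - m) / h) ((b - m) / h) := by
    ext u
    simp only [Set.mem_ofPred_eq, Set.mem_Ioc, div_lt_iff₀ hh, le_div_iff₀ hh]
    constructor <;> rintro ⟨h1, h2⟩ <;> constructor <;> linarith
  rw [h1, offsetLaw_real_apply, Set.inter_eq_right.mpr,
    Real.volume_real_Ioc_of_le (by gcongr), ← sub_div]
  · field_simp
    ring
  · intro u hu
    have h2 : -1 ≤ (a - m) / h := by rw [le_div_iff₀ hh]; linarith
    have h3 : (b - m) / h ≤ 1 := by rw [div_le_iff₀ hh]; linarith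
    exact ⟨h2.trans hu.1.le, hu.2.trans h3⟩

end Offset

lemma integrable_ite_one {Ω : Type*} [MeasurableSpace Ω] {μ : Measure Ω} [IsFiniteMeasure μ]
    {P : Ω → Prop} [DecidablePred P] (hP : MeasurableSet {ω | P ω}) :
    Integrable (fun ω => if P ω then (1 : ℝ) else 0) μ := by
  classical
  refine ((integrable_const (1 : ℝ)).indicator hP).congr (.of_forall fun ω => ?_)
  simp [Set.indicator]

lemma integral_ite_one {Ω : Type*} [MeasurableSpace Ω] {μ : Measure Ω}
    {P : Ω → Prop} [DecidablePred P] (hP : MeasurableSet {ω | P ω}) :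
    ∫ ω, (if P ω then (1 : ℝ) else 0) ∂μ = μ.real {ω | P ω} := by
  classical
  rw [← integral_indicator_one hP]
  refine integral_congr_ae (.of_forall fun ω => ?_)
  simp [Set.indicator]

/-- The set `A` meets both of the balls of radius `r` around `c` and `c'`. -/
def MeetsBoth (c c' : Pt D) (r : ℝ) (A : Finset (Pt D)) : Prop :=
  (∃ z ∈ A, dist z c ≤ r) ∧ ∃ z ∈ A, dist z c' ≤ r

lemma MeetsBoth.mono {c c' : Pt D} {r : ℝ} {A B : Finset (Pt D)} (h : MeetsBoth c c' r A)
    (hAB : A ⊆ B) : MeetsBoth c c' r B := by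
  obtain ⟨⟨x, hx, hxc⟩, y, hy, hyc⟩ := h
  exact ⟨⟨x, hAB hx, hxc⟩, y, hAB hy, hyc⟩

lemma dist_le_maxDist {A : Finset (Pt D)} {z : Pt D} (hz : z ∈ A) (p : Pt D) :
    dist p z ≤ maxDist A p :=
  le_ciSup (f := fun y : {y : Pt D // y ∈ A} => dist p y) (Set.finite_range _).bddAbove ⟨z, hz⟩

lemma maxDist_le {A : Finset (Pt D)} {p : Pt D} {R : ℝ} (hA : A.Nonempty)
    (h : ∀ z ∈ A, dist p z ≤ R) : maxDist A p ≤ R := by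
  have : Nonempty {y : Pt D // y ∈ A} := hA.to_subtype
  exact ciSup_le fun y => h y y.2

open Classical in
/-- A threshold `θ` that separates `f x` from `f y`, and that cuts neither ball, leaves no child
meeting both balls. -/
lemma sum_meetsBoth_le {A L R : Finset (Pt D)} {f : Pt D → ℝ} {θ MX MY r : ℝ} {c c' x y : Pt D}
    (hL : ∀ z ∈ L, z ∈ A ∧ f z < θ) (hR : ∀ z ∈ R, z ∈ A ∧ θ ≤ f z)
    (hX : ∀ z ∈ A, dist z c ≤ r → |f x - f z| ≤ MX)
    (hY : ∀ z ∈ A, dist z c' ≤ r → |f y - f z| ≤ MY) :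
    ((if MeetsBoth c c' r L then (1 : ℝ) else 0) + (if MeetsBoth c c' r R then 1 else 0)) ≤
      1 - (if min (f x) (f y) < θ ∧ θ ≤ max (f x) (f y) then 1 else 0) +
        (if |θ - f x| ≤ MX then 1 else 0) + (if |θ - f y| ≤ MY then 1 else 0) := by
  have kL : MeetsBoth c c' r L → (f x < θ ∨ |θ - f x| ≤ MX) ∧ (f y < θ ∨ |θ - f y| ≤ MY) := by
    rintro ⟨⟨z, hz, hzc⟩, z', hz', hzc'⟩
    obtain ⟨h1, h2⟩ := hL z hz
    obtain ⟨h3, h4⟩ := hL z' hz'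
    have h5 := abs_le.mp (hX z h1 hzc)
    have h6 := abs_le.mp (hY z' h3 hzc')
    constructor
    · by_contra! hcon
      rw [abs_of_nonpos (by linarith)] at hcon
      linarith
    · by_contra! hcon
      rw [abs_of_nonpos (by linarith)] at hcon
      linarith
  have kR : MeetsBoth c c' r R → (θ ≤ f x ∨ |θ - f x| ≤ MX) ∧ (θ ≤ f y ∨ |θ - f y| ≤ MY) := by
    rintro ⟨⟨z, hz, hzc⟩, z', hz', hzc'⟩
    obtain ⟨h1, h2⟩ := hR z hz
    obtain ⟨h3, h4⟩ := hR z' hz'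
    have h5 := abs_le.mp (hX z h1 hzc)
    have h6 := abs_le.mp (hY z' h3 hzc')
    constructor
    · by_contra! hcon
      rw [abs_of_nonneg (by linarith)] at hcon
      linarith
    · by_contra! hcon
      rw [abs_of_nonneg (by linarith)] at hcon
      linarith
  -- A ball that is not cut has all its data on one side. If both are cut, the right side is at
  -- least `2`; if one is cut, separation leaves at most one child, as the uncut ball has only one;
  -- if none is cut, separation leaves no child.
  by_cases hx : |θ - f x| ≤ MX <;> by_cases hy : |θ - f y| ≤ MY
  · simp only [hx, hy, if_true]
    split_ifs <;> norm_num
  all_goals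
    simp only [hx, hy, or_false, or_true, and_true, true_and] at kL kR
    by_cases hJL : MeetsBoth c c' r L <;> by_cases hJR : MeetsBoth c c' r R
    all_goals simp only [hx, hy, hJL, hJR, if_true, if_false, true_imp_iff, false_imp_iff] at kL kR ⊢
  all_goals split_ifs with hs
  all_goals try norm_num
  all_goals first
    | linarith
    | (exfalso
       first
        | linarith [kL.1, kR.1]
        | (have := max_lt kL.1 kL.2; linarith [hs.2])
        | (have := le_min kR.1 kR.2; linarith [hs.1]))

open Classical in
/-- Expected number of children that meet both balls, over the random offset for a fixed
direction. -/
lemma integral_offset_meetsBoth_le {A : Finset (Pt D)} {p v c c' x y : Pt D} {r MX MY : ℝ}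
    (hh : 0 < 6 * maxDist A p / √D) (hMX : 0 ≤ MX) (hMY : 0 ≤ MY)
    (hX : ∀ z ∈ A, dist z c ≤ r → |inner ℝ (x - z) v| ≤ MX)
    (hY : ∀ z ∈ A, dist z c' ≤ r → |inner ℝ (y - z) v| ≤ MY) :
    ∫ u, ((if MeetsBoth c c' r (childData A p (v, u) true) then (1 : ℝ) else 0) +
        (if MeetsBoth c c' r (childData A p (v, u) false) then 1 else 0)) ∂offsetLaw ≤
      1 - offsetLaw.real {u | min (inner ℝ x v) (inner ℝ y v) <
          median A (fun z => inner ℝ z v) + u * (6 * maxDist A p / √D) ∧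
          median A (fun z => inner ℝ z v) + u * (6 * maxDist A p / √D) ≤
            max (inner ℝ x v) (inner ℝ y v)} +
        MX / (6 * maxDist A p / √D) + MY / (6 * maxDist A p / √D) := by
  set m := median A (fun z => inner ℝ z v) with hm
  set h := 6 * maxDist A p / √D with hhdef
  have hmeas : ∀ t, MeasurableSet {u : ℝ | MeetsBoth c c' r (childData A p (v, u) t)} := fun t =>
    (measurableSet_childData A p t {B | MeetsBoth c c' r B}).preimage
      (f := fun u : ℝ => ((v, u) : Split D)) (by fun_prop)
  have hs : MeasurableSet {u : ℝ | min (inner ℝ x v) (inner ℝ y v) < m + u * h ∧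
      m + u * h ≤ max (inner ℝ x v) (inner ℝ y v)} :=
    MeasurableSet.inter (s₁ := {u : ℝ | min (inner ℝ x v) (inner ℝ y v) < m + u * h})
      (s₂ := {u : ℝ | m + u * h ≤ max (inner ℝ x v) (inner ℝ y v)})
      (measurableSet_lt (by fun_prop) (by fun_prop)) (measurableSet_le (by fun_prop) (by fun_prop))
  have hc : ∀ a M : ℝ, MeasurableSet {u : ℝ | |m + u * h - a| ≤ M} := fun a M =>
    measurableSet_le (by fun_prop) (by fun_prop)
  let s₁ : ℝ → ℝ := fun u => if min (inner ℝ x v) (inner ℝ y v) < m + u * h ∧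
      m + u * h ≤ max (inner ℝ x v) (inner ℝ y v) then 1 else 0
  let s₂ : ℝ → ℝ := fun u => if |m + u * h - inner ℝ x v| ≤ MX then 1 else 0
  let s₃ : ℝ → ℝ := fun u => if |m + u * h - inner ℝ y v| ≤ MY then 1 else 0
  have i₁ : Integrable s₁ offsetLaw := integrable_ite_one hs
  have i₂ : Integrable s₂ offsetLaw := integrable_ite_one (hc _ _)
  have i₃ : Integrable s₃ offsetLaw := integrable_ite_one (hc _ _)
  have j₁ : Integrable (fun u => 1 - s₁ u) offsetLaw := (integrable_const (1 : ℝ)).sub i₁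
  have j₂ : Integrable (fun u => 1 - s₁ u + s₂ u) offsetLaw := j₁.add i₂
  calc _ ≤ ∫ u, (1 - s₁ u + s₂ u + s₃ u) ∂offsetLaw := by
        refine integral_mono ((integrable_ite_one (hmeas true)).add
          (integrable_ite_one (hmeas false))) (j₂.add i₃) (fun u => ?_)
        refine sum_meetsBoth_le (A := A) (f := fun z => inner ℝ z v) (θ := m + u * h) (x := x)
          (y := y) (MX := MX) (MY := MY) (fun z hz => ?_) (fun z hz => ?_) (fun z hz hzc => ?_)
          (fun z hz hzc => ?_)
        · have := mem_childData.mp hz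
          exact ⟨this.1, this.2.mpr rfl⟩
        · have := mem_childData.mp hz
          exact ⟨this.1, not_lt.mp fun h' => by simpa using this.2.mp h'⟩
        · simpa only [inner_sub_left] using hX z hz hzc
        · simpa only [inner_sub_left] using hY z hz hzc
    _ = 1 - offsetLaw.real {u | min (inner ℝ x v) (inner ℝ y v) < m + u * h ∧
          m + u * h ≤ max (inner ℝ x v) (inner ℝ y v)} +
        offsetLaw.real {u | |m + u * h - inner ℝ x v| ≤ MX} +
        offsetLaw.real {u | |m + u * h - inner ℝ y v| ≤ MY} := by
        rw [integral_add j₂ i₃, integral_add j₁ i₂, integral_sub (integrable_const (1 : ℝ)) i₁,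
          integral_ite_one hs, integral_ite_one (hc _ _), integral_ite_one (hc _ _)]
        simp
    _ ≤ _ := by
        gcongr
        · exact offsetLaw_real_near_le hh hMX
        · exact offsetLaw_real_near_le hh hMY

/-- Sum of the fourth powers that control how far the projections of `x`, of `y` and the median are
from the projection of `p`. -/
noncomputable def deviation (A : Finset (Pt D)) (p x y v : Pt D) : ℝ :=
  (inner ℝ (x - p) v) ^ 4 + (inner ℝ (y - p) v) ^ 4 +
    2 / A.card * ∑ z ∈ A, (inner ℝ (z - p) v) ^ 4

lemma pow_four_nonneg (t : ℝ) : 0 ≤ t ^ 4 := (by decide : Even 4).pow_nonneg t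

lemma sum_pow_four_nonneg (A : Finset (Pt D)) (p v : Pt D) :
    0 ≤ 2 / (A.card : ℝ) * ∑ z ∈ A, (inner ℝ (z - p) v : ℝ) ^ 4 :=
  mul_nonneg (by positivity) (Finset.sum_nonneg fun _ _ => pow_four_nonneg _)

lemma deviation_nonneg (A : Finset (Pt D)) (p x y v : Pt D) : 0 ≤ deviation A p x y v :=
  add_nonneg (add_nonneg (pow_four_nonneg _) (pow_four_nonneg _)) (sum_pow_four_nonneg A p v)

lemma pow_four_le_of_le_abs {H t : ℝ} (hH : 0 ≤ H) (h : H ≤ |t|) : H ^ 4 ≤ t ^ 4 := by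
  have : t ^ 4 = |t| ^ 4 := by rw [(by decide : Even 4).pow_abs]
  rw [this]
  gcongr

/-- A fourth-power Markov argument. When the median is far from the projection of `p`, at least half
of the points contribute `H ^ 4`, and the factor `2 / A.card` makes up for the other half. -/
lemma le_deviation {A : Finset (Pt D)} (hA : A.Nonempty) {p x y v : Pt D} {H : ℝ} (hH : 0 ≤ H)
    (h : H < |inner ℝ (x - p) v| ∨ H < |inner ℝ (y - p) v| ∨
      H < |median A (fun z => inner ℝ z v) - inner ℝ p v|) :
    H ^ 4 ≤ deviation A p x y v := by
  classical
  unfold deviation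
  have hx := pow_four_nonneg (inner ℝ (x - p) v)
  have hy := pow_four_nonneg (inner ℝ (y - p) v)
  have hs := sum_pow_four_nonneg A p v
  rcases h with h | h | h
  · linarith [pow_four_le_of_le_abs hH h.le]
  · linarith [pow_four_le_of_le_abs hH h.le]
  · have h1 := card_le_two_mul_card_of_lt_abs_median_sub hA h
    have h2 : ((A.filter fun z => H ≤ |inner ℝ z v - inner ℝ p v|).card : ℝ) * H ^ 4 ≤
        ∑ z ∈ A, (inner ℝ (z - p) v) ^ 4 := by
      rw [← nsmul_eq_mul]
      refine (Finset.card_nsmul_le_sum _ (fun z => (inner ℝ (z - p) v : ℝ) ^ 4) _ fun z hz => ?_).trans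
        (Finset.sum_le_sum_of_subset_of_nonneg (Finset.filter_subset _ _) fun z _ _ => pow_four_nonneg _)
      rw [inner_sub_left]
      exact pow_four_le_of_le_abs hH (Finset.mem_filter.mp hz).2
    have h3 : (A.card : ℝ) ≤ 2 * ((A.filter fun z => H ≤ |inner ℝ z v - inner ℝ p v|).card : ℝ) := by
      exact_mod_cast h1
    have hc : (0 : ℝ) < A.card := by exact_mod_cast hA.card_pos
    have h4 : H ^ 4 ≤ 2 / A.card * ∑ z ∈ A, (inner ℝ (z - p) v) ^ 4 := by
      rw [div_mul_eq_mul_div, le_div_iff₀ hc]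
      nlinarith [pow_four_nonneg H]
    linarith

lemma integrable_deviation (A : Finset (Pt D)) (p x y : Pt D) :
    Integrable (deviation A p x y) (directionLaw D) :=
  ((integrable_inner_pow_directionLaw _ _).add (integrable_inner_pow_directionLaw _ _)).add
    ((integrable_finsetSum _ fun _ _ => integrable_inner_pow_directionLaw _ _).const_mul _)

lemma integral_inner_pow_four_directionLaw_le (hD : 0 < D) {z : Pt D} {R : ℝ} (hz : ‖z‖ ≤ R) :
    ∫ v, (inner ℝ z v) ^ 4 ∂(directionLaw D) ≤ 3 * R ^ 4 / D ^ 2 := by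
  have h := integral_inner_pow_directionLaw_le hD z 2
  norm_num [Nat.doubleFactorial] at h
  refine h.trans ?_
  rw [mul_comm]
  gcongr

lemma integral_deviation_le (hD : 0 < D) {A : Finset (Pt D)} (hA : A.Nonempty) {p x y : Pt D}
    (hx : x ∈ A) (hy : y ∈ A) :
    ∫ v, deviation A p x y v ∂(directionLaw D) ≤ 12 * maxDist A p ^ 4 / D ^ 2 := by
  have hb : ∀ z ∈ A, ∫ v, (inner ℝ (z - p) v) ^ 4 ∂(directionLaw D) ≤
      3 * maxDist A p ^ 4 / D ^ 2 := fun z hz => by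
    refine integral_inner_pow_four_directionLaw_le hD ?_
    rw [← dist_eq_norm, dist_comm]
    exact dist_le_maxDist hz p
  have i := fun z : Pt D => integrable_inner_pow_directionLaw (z - p) 4
  have i2 : Integrable (fun v => (inner ℝ (x - p) v) ^ 4 + (inner ℝ (y - p) v) ^ 4)
    (directionLaw D) := (i x).add (i y)
  unfold deviation
  rw [integral_add i2 ((integrable_finsetSum _ fun z _ => i z).const_mul _),
    integral_add (i x) (i y), integral_const_mul, integral_finsetSum _ fun z _ => i z]
  have hs := Finset.sum_le_card_nsmul A _ _ hb
  have hc : (0 : ℝ) < A.card := by exact_mod_cast hA.card_pos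
  rw [nsmul_eq_mul] at hs
  calc _ ≤ 3 * maxDist A p ^ 4 / D ^ 2 + 3 * maxDist A p ^ 4 / D ^ 2 +
        2 / A.card * (A.card * (3 * maxDist A p ^ 4 / D ^ 2)) := by
        gcongr
        · exact hb x hx
        · exact hb y hy
    _ = _ := by field_simp; ring

/-- For a fixed direction, a lower bound for the probability that the threshold separates the
projections of `x` and `y`. -/
lemma le_offsetLaw_real_separated {A : Finset (Pt D)} (hA : A.Nonempty) {p x y v : Pt D} {h τ : ℝ}
    (hh : 0 < h) (hτ : 0 < τ) :
    τ / (2 * h) * (7 / 10 * (inner ℝ (x - y) v / τ) ^ 2 - 27 / 250 * (inner ℝ (x - y) v / τ) ^ 4 -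
        5 / 4 * (deviation A p x y v / (h / 2) ^ 4)) ≤
      offsetLaw.real {u | min (inner ℝ x v) (inner ℝ y v) <
          median A (fun z => inner ℝ z v) + u * h ∧
          median A (fun z => inner ℝ z v) + u * h ≤ max (inner ℝ x v) (inner ℝ y v)} := by
  set m := median A (fun z => inner ℝ z v) with hm
  set T : ℝ := inner ℝ (x - y) v / τ with hT
  have hB : 0 ≤ deviation A p x y v / (h / 2) ^ 4 :=
    div_nonneg (deviation_nonneg _ _ _ _ _) (by positivity)
  have hT1 := abs_lower_bound T
  by_cases hok : h / 2 < |inner ℝ (x - p) v| ∨ h / 2 < |inner ℝ (y - p) v| ∨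
      h / 2 < |m - inner ℝ p v|
  · have h1 : 1 ≤ deviation A p x y v / (h / 2) ^ 4 := by
      rw [one_le_div (by positivity)]
      exact le_deviation hA (by positivity) hok
    refine le_trans ?_ measureReal_nonneg
    refine mul_nonpos_of_nonneg_of_nonpos (by positivity) ?_
    -- The coefficient `7 / 10` gives up `T ^ 2 / 5` from `abs_lower_bound`, and `|T| ≤ T ^ 2 / 5 +
    -- 5 / 4`; so the penalty `5 / 4` makes the left side nonpositive on the exceptional event.
    nlinarith [sq_nonneg (|T| - 5 / 2), sq_abs T]
  · push Not at hok
    obtain ⟨h1, h2, h3⟩ := hok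
    rw [inner_sub_left, abs_le] at h1 h2
    rw [abs_le] at h3
    -- Both projections and the median are within `h / 2` of the projection of `p`, so the whole gap
    -- lies in the window `[m - h, m + h]` of the threshold.
    rw [offsetLaw_real_between hh min_le_max
      (by rw [le_min_iff]; constructor <;> linarith) (by rw [max_le_iff]; constructor <;> linarith),
      max_sub_min_eq_abs']
    have h4 : |(inner ℝ x v : ℝ) - inner ℝ y v| / (2 * h) = τ / (2 * h) * |T| := by
      rw [hT, inner_sub_left, abs_div, abs_of_pos hτ]
      field_simp
    rw [h4]
    gcongr
    nlinarith [sq_nonneg T]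

/-- The three normalized means are `1`, at most `3`, and at most `12 / 3 ^ 4 = 4 / 27`, since `h /
2` is `3 * maxDist A p / √D`. What remains, `7 / 10 - 81 / 250 - 5 / 27`, exceeds `3 / 16`. -/
lemma le_integral_separation_bound (hD : 0 < D) {A : Finset (Pt D)} (hA : A.Nonempty)
    {p x y : Pt D} (hx : x ∈ A) (hy : y ∈ A) (hxy : x ≠ y) (hp : 0 < maxDist A p) :
    3 / 16 ≤ ∫ v, (7 / 10 * (inner ℝ (x - y) v / (dist x y / √D)) ^ 2 -
        27 / 250 * (inner ℝ (x - y) v / (dist x y / √D)) ^ 4 -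
        5 / 4 * (deviation A p x y v / (6 * maxDist A p / √D / 2) ^ 4)) ∂(directionLaw D) := by
  have hD' : (0 : ℝ) < D := by exact_mod_cast hD
  have hd : 0 < dist x y := dist_pos.mpr hxy
  have h4 : √(D : ℝ) ^ 4 = (D : ℝ) ^ 2 := by
    rw [show 4 = 2 * 2 from rfl, pow_mul, Real.sq_sqrt hD'.le]
  have hs2 : ∫ v, (inner ℝ (x - y) v / (dist x y / √D)) ^ 2 ∂(directionLaw D) = 1 := by
    simp_rw [div_pow]
    rw [integral_div, integral_inner_sq_directionLaw hD, ← dist_eq_norm, Real.sq_sqrt hD'.le]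
    field_simp
  have hs4 : ∫ v, (inner ℝ (x - y) v / (dist x y / √D)) ^ 4 ∂(directionLaw D) ≤ 3 := by
    simp_rw [div_pow]
    rw [integral_div, h4, div_le_iff₀ (by positivity)]
    refine (integral_inner_pow_four_directionLaw_le hD (R := dist x y)
      (by rw [dist_eq_norm])).trans (le_of_eq (by ring))
  have hdev : ∫ v, deviation A p x y v / (6 * maxDist A p / √D / 2) ^ 4 ∂(directionLaw D) ≤
      4 / 27 := by
    rw [integral_div, div_le_iff₀ (by positivity)]
    refine (integral_deviation_le hD hA hx hy).trans (le_of_eq ?_)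
    simp_rw [div_pow]
    rw [h4]
    ring
  have i := fun n => (integrable_inner_pow_directionLaw (x - y) n).div_const ((dist x y / √D) ^ n)
  simp_rw [← div_pow] at i
  have i24 : Integrable (fun v => 7 / 10 * (inner ℝ (x - y) v / (dist x y / √D)) ^ 2 -
      27 / 250 * (inner ℝ (x - y) v / (dist x y / √D)) ^ 4) (directionLaw D) :=
    ((i 2).const_mul _).sub ((i 4).const_mul _)
  rw [integral_sub i24 (((integrable_deviation A p x y).div_const _).const_mul _),
    integral_sub ((i 2).const_mul _) ((i 4).const_mul _), integral_const_mul, integral_const_mul,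
    integral_const_mul, hs2]
  linarith

open Classical in
/-- A split of a cell of low doubling dimension makes it less likely, in the mean over the children,
that two well separated small balls are met at once. -/
lemma integral_meetsBoth_childData_le {A : Finset (Pt D)} {p : Pt D}
    (hp : p ∈ A) {d : ℕ} (hd : 1 ≤ d) (hA : CoversByHalving (A : Set (Pt D)) d)
    {c c' : Pt D} {r δ Λ : ℝ} (hr : 0 < r) (hδ : 0 < δ) (hrδ : 8320 * d * r ≤ δ)
    (hΛ : maxDist A p ≤ Λ)
    (hsep : ∀ x y, dist x c ≤ r → dist y c' ≤ r → δ ≤ dist x y) (hJ : MeetsBoth c c' r A) :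
    ∫ σ, ((if MeetsBoth c c' r (childData A p σ true) then (1 : ℝ) else 0) +
        (if MeetsBoth c c' r (childData A p σ false) then 1 else 0)) ∂(splitLaw D) ≤
      1 - δ / (96 * Λ) := by
  obtain ⟨⟨x, hx, hxc⟩, y, hy, hyc⟩ := hJ
  have hxy : δ ≤ dist x y := hsep x y hxc hyc
  have hxy0 : x ≠ y := by rintro rfl; simp at hxy; linarith
  have hD : 0 < D := by
    by_contra hD
    obtain rfl : D = 0 := by omega
    exact hxy0 (Subsingleton.elim _ _)
  have hA0 : A.Nonempty := ⟨p, hp⟩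
  have hD' : (0 : ℝ) < D := by exact_mod_cast hD
  have hΔ : 0 < maxDist A p := by
    have h1 := dist_triangle_left x y p
    linarith [dist_le_maxDist hx p, dist_le_maxDist hy p]
  obtain ⟨MX, hMXi, hMX, hMXle⟩ := exists_projection_diam_bound hD hd hA c hr
  obtain ⟨MY, hMYi, hMY, hMYle⟩ := exists_projection_diam_bound hD hd hA c' hr
  set h := 6 * maxDist A p / √D with hhdef
  have hh : 0 < h := by positivity
  set τ := dist x y / √D with hτdef
  have hτ : 0 < τ := by have := dist_pos.mpr hxy0; positivity
  let Q : Pt D → ℝ := fun v => 7 / 10 * (inner ℝ (x - y) v / τ) ^ 2 -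
    27 / 250 * (inner ℝ (x - y) v / τ) ^ 4 - 5 / 4 * (deviation A p x y v / (h / 2) ^ 4)
  have hQ : 3 / 16 ≤ ∫ v, Q v ∂(directionLaw D) :=
    le_integral_separation_bound hD hA0 hx hy hxy0 hΔ
  have hQi : Integrable Q (directionLaw D) := by
    have i := fun n => (integrable_inner_pow_directionLaw (x - y) n).div_const (τ ^ n)
    simp_rw [← div_pow] at i
    exact (((i 2).const_mul _).sub ((i 4).const_mul _)).sub
      (((integrable_deviation A p x y).div_const _).const_mul _)
  have hmeas : ∀ t, Integrable (fun σ : Split D =>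
      if MeetsBoth c c' r (childData A p σ t) then (1 : ℝ) else 0)
      ((directionLaw D).prod offsetLaw) := fun t =>
    integrable_ite_one (measurableSet_childData A p t {B | MeetsBoth c c' r B})
  have hint := (hmeas true).add (hmeas false)
  have i1 : Integrable (fun v => 1 - τ / (2 * h) * Q v) (directionLaw D) :=
    (integrable_const 1).sub (hQi.const_mul _)
  have i2 : Integrable (fun v => 1 - τ / (2 * h) * Q v + MX v / h) (directionLaw D) :=
    i1.add (hMXi.div_const h)
  calc _ = ∫ v, ∫ u, ((if MeetsBoth c c' r (childData A p (v, u) true) then (1 : ℝ) else 0) +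
        (if MeetsBoth c c' r (childData A p (v, u) false) then 1 else 0)) ∂offsetLaw
          ∂(directionLaw D) := by rw [splitLaw]; exact integral_prod _ hint
    _ ≤ ∫ v, (1 - τ / (2 * h) * Q v + MX v / h + MY v / h) ∂(directionLaw D) := by
        refine integral_mono_ae hint.integral_prod_left (i2.add (hMYi.div_const h)) ?_
        filter_upwards [norm_le_one_of_directionLaw] with v hv
        refine (integral_offset_meetsBoth_le hh
          ((abs_nonneg _).trans (hMX v hv x hx hxc x hx hxc))
          ((abs_nonneg _).trans (hMY v hv y hy hyc y hy hyc))
          (fun z hz hzc => hMX v hv x hx hxc z hz hzc)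
          (fun z hz hzc => hMY v hv y hy hyc z hz hzc)).trans ?_
        gcongr
        exact le_offsetLaw_real_separated hA0 hh hτ
    _ = 1 - τ / (2 * h) * ∫ v, Q v ∂(directionLaw D) + (∫ v, MX v ∂(directionLaw D)) / h +
          (∫ v, MY v ∂(directionLaw D)) / h := by
        rw [integral_add i2 (hMYi.div_const h), integral_add i1 (hMXi.div_const h),
          integral_sub (integrable_const 1) (hQi.const_mul _), integral_const_mul, integral_div,
          integral_div]
        simp
    -- Since `8320 = 130 * 64`, the cutting terms total `1 / 32` in units of `δ / (√D * h)`, against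
    -- a gain of `3 / 32`.
    _ ≤ 1 - (δ / √D) / (2 * h) * (3 / 16) + (δ / 64 / √D) / h + (δ / 64 / √D) / h := by
        have hd' : (1 : ℝ) ≤ d := by exact_mod_cast hd
        have hrd : 130 * r * √d ≤ δ / 64 := by
          have h1 : √(d : ℝ) ≤ d := Real.sqrt_le_self_iff.mpr (Or.inr hd')
          nlinarith
        have h1 : δ / √D ≤ τ := by rw [hτdef]; gcongr
        have h2 : 130 * r * √d / √D ≤ δ / 64 / √D := by gcongr
        have h3 := hMXle.trans h2
        have h4 := hMYle.trans h2
        gcongr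
    _ = 1 - δ / (96 * maxDist A p) := by
        rw [hhdef]
        field_simp
        ring
    _ ≤ _ := by gcongr

/-! ### Independence along the tree and contraction of potentials. -/

lemma cellData_subset (A : Finset (Pt D)) (pick : Node → Finset (Pt D) → Pt D)
    (ω : Node → Split D) (n : Node) : cellData A pick ω n ⊆ A := by
  induction n with
  | nil => exact Finset.Subset.refl _
  | cons t n ih => exact (childData_subset _ _ _ _).trans ih

lemma cellData_append_subset (A : Finset (Pt D)) (pick : Node → Finset (Pt D) → Pt D)
    (ω : Node → Split D) (u n : Node) : cellData A pick ω (u ++ n) ⊆ cellData A pick ω n := by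
  induction u with
  | nil => exact Finset.Subset.refl _
  | cons t u ih => exact (childData_subset _ _ _ _).trans ih

/-- The cell at a node only depends on the splits at its proper ancestors. -/
lemma cellData_congr {A : Finset (Pt D)} {pick : Node → Finset (Pt D) → Pt D}
    {ω ω' : Node → Split D} {n : Node} (h : ∀ m, m <:+ n → m ≠ n → ω m = ω' m) :
    cellData A pick ω n = cellData A pick ω' n := by
  induction n with
  | nil => rfl
  | cons t n ih =>
    have h1 : cellData A pick ω n = cellData A pick ω' n := by
      refine ih fun m hm hmn => h m (hm.trans (List.suffix_cons t n)) ?_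
      rintro rfl
      have := hm.length_le
      simp at this
    have h2 : ω n = ω' n := h n (List.suffix_cons t n) fun h' => by
      have := congrArg List.length h'
      simp at this
    simp only [cellData, h1, h2]

lemma setOf_cellData_cons_mem (A : Finset (Pt D)) (pick : Node → Finset (Pt D) → Pt D) (n : Node)
    (t : Bool) (s : Set (Finset (Pt D))) :
    {ω : Node → Split D | cellData A pick ω (t :: n) ∈ s} =
      ⋃ B ∈ A.powerset, {ω | cellData A pick ω n = B} ∩
        {ω | childData B (pick n B) (ω n) t ∈ s} := by
  ext ω
  simp only [Set.mem_ofPred_eq, Set.mem_iUnion, Set.mem_inter_iff, exists_prop,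
    Finset.mem_powerset, cellData]
  constructor
  · exact fun h => ⟨_, cellData_subset A pick ω n, rfl, h⟩
  · rintro ⟨B, -, rfl, h⟩
    exact h

lemma measurableSet_cellData (A : Finset (Pt D)) (pick : Node → Finset (Pt D) → Pt D) (n : Node)
    (s : Set (Finset (Pt D))) : MeasurableSet {ω : Node → Split D | cellData A pick ω n ∈ s} := by
  induction n generalizing s with
  | nil => exact MeasurableSet.const (A ∈ s)
  | cons t n ih =>
    rw [setOf_cellData_cons_mem]
    refine Finset.measurableSet_biUnion _ fun B _ => MeasurableSet.inter (ih {B}) ?_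
    exact (measurableSet_childData B (pick n B) t s).preimage (measurable_pi_apply n)

/-- The cell at a node is independent of the split at that node. -/
lemma treeLaw_real_cellData_inter (A : Finset (Pt D)) (pick : Node → Finset (Pt D) → Pt D)
    (n : Node) (B : Finset (Pt D)) {U : Set (Split D)} (hU : MeasurableSet U) :
    (treeLaw D).real ({ω | cellData A pick ω n = B} ∩ {ω | ω n ∈ U}) =
      (treeLaw D).real {ω | cellData A pick ω n = B} * (splitLaw D).real U := by
  classical
  let T : Finset Node := n.tails.toFinset.erase n
  have hind : iIndepFun (fun (i : Node) (ω : Node → Split D) => ω i) (treeLaw D) :=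
    iIndepFun_infinitePi (X := fun _ ω => ω) fun _ => measurable_id
  have h1 := hind.indepFun_finset T {n} (by simp [T]) (fun i => measurable_pi_apply i)
  -- The value `0` away from the proper ancestors of `n` is never read by the cell at `n`.
  let ext : (T → Split D) → Node → Split D := fun x m => if hm : m ∈ T then x ⟨m, hm⟩ else 0
  have hext : Measurable ext := by
    refine measurable_pi_lambda _ fun m => ?_
    by_cases hm : m ∈ T
    · simpa [ext, hm] using measurable_pi_apply (X := fun _ : T => Split D) (⟨m, hm⟩ : T)
    · simp [ext, hm]
  have hcell : {ω : Node → Split D | cellData A pick ω n = B} =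
      (fun ω (i : T) => ω i) ⁻¹' {x | cellData A pick (ext x) n = B} := by
    ext ω
    simp only [Set.mem_ofPred_eq, Set.mem_preimage]
    rw [cellData_congr (ω := ω) (ω' := ext fun i => ω i)]
    intro m hm hmn
    have : m ∈ T := by simp [T, hmn, hm]
    simp [ext, this]
  have hsplit : {ω : Node → Split D | ω n ∈ U} =
      (fun ω (i : ({n} : Finset Node)) => ω i) ⁻¹' {x | x ⟨n, by simp⟩ ∈ U} := rfl
  have h2 := h1.measure_inter_preimage_eq_mul _ _
    ((measurableSet_cellData A pick n {B}).preimage hext)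
    (hU.preimage (measurable_pi_apply (⟨n, by simp⟩ : ({n} : Finset Node))))
  have h3 : (treeLaw D) {ω | ω n ∈ U} = splitLaw D U := by
    have h4 := Measure.infinitePi_map_eval (fun _ : Node => splitLaw D) n
    conv_rhs => rw [← h4]
    rw [Measure.map_apply (measurable_pi_apply n) hU]
    rfl
  simp only [measureReal_def]
  rw [← h3, ← ENNReal.toReal_mul]
  congr 1
  rw [hcell, hsplit]
  exact h2

/-- Expectation of a function of a random subset of a finite set. -/
lemma integral_comp_subset {Ω : Type*} [MeasurableSpace Ω] {μ : Measure Ω} [IsFiniteMeasure μ]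
    {A : Finset (Pt D)} {F : Ω → Finset (Pt D)} (hFA : ∀ ω, F ω ⊆ A)
    (hF : ∀ B, MeasurableSet {ω | F ω = B}) (g : Finset (Pt D) → ℝ) :
    ∫ ω, g (F ω) ∂μ = ∑ B ∈ A.powerset, μ.real {ω | F ω = B} * g B := by
  classical
  have h1 : ∀ ω, g (F ω) = ∑ B ∈ A.powerset, (if F ω = B then (1 : ℝ) else 0) * g B := by
    intro ω
    simp [hFA ω]
  simp_rw [h1]
  rw [integral_finsetSum _ fun B _ => (integrable_ite_one (hF B)).mul_const _]
  exact Finset.sum_congr rfl fun B _ => by rw [integral_mul_const, integral_ite_one (hF B)]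

lemma integrable_comp_subset {Ω : Type*} [MeasurableSpace Ω] {μ : Measure Ω} [IsFiniteMeasure μ]
    {A : Finset (Pt D)} {F : Ω → Finset (Pt D)} (hFA : ∀ ω, F ω ⊆ A)
    (hF : ∀ B, MeasurableSet {ω | F ω = B}) (g : Finset (Pt D) → ℝ) :
    Integrable (fun ω => g (F ω)) μ := by
  classical
  have h1 : ∀ ω, g (F ω) = ∑ B ∈ A.powerset, (if F ω = B then (1 : ℝ) else 0) * g B := by
    intro ω
    simp [hFA ω]
  simp_rw [h1]
  exact integrable_finsetSum _ fun B _ => (integrable_ite_one (hF B)).mul_const _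

/-- The Markov property: given the cell at `n`, the split at `n` is still a fresh sample of
`splitLaw D`. -/
lemma integral_cellData_cons (A : Finset (Pt D)) (pick : Node → Finset (Pt D) → Pt D) (n : Node)
    (t : Bool) (g : Finset (Pt D) → ℝ) :
    ∫ ω, g (cellData A pick ω (t :: n)) ∂(treeLaw D) =
      ∑ B ∈ A.powerset, (treeLaw D).real {ω | cellData A pick ω n = B} *
        ∫ σ, g (childData B (pick n B) σ t) ∂(splitLaw D) := by
  classical
  rw [integral_comp_subset (fun ω => cellData_subset A pick ω (t :: n))
    (fun B => measurableSet_cellData A pick (t :: n) {B})]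
  have h1 : ∀ C, (treeLaw D).real {ω | cellData A pick ω (t :: n) = C} =
      ∑ B ∈ A.powerset, (treeLaw D).real {ω | cellData A pick ω n = B} *
        (splitLaw D).real {σ | childData B (pick n B) σ t = C} := by
    intro C
    have h2 := setOf_cellData_cons_mem A pick n t {C}
    simp only [Set.mem_singleton_iff] at h2
    rw [h2, measureReal_biUnion_finset]
    · exact Finset.sum_congr rfl fun B _ => treeLaw_real_cellData_inter A pick n B
        (measurableSet_childData B (pick n B) t {C})
    · intro B _ B' _ hBB
      refine Set.disjoint_left.mpr fun ω h h' => hBB ?_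
      exact h.1.symm.trans h'.1
    · intro B _
      exact (measurableSet_cellData A pick n {B}).inter
        ((measurableSet_childData B (pick n B) t {C}).preimage (measurable_pi_apply n))
  simp_rw [h1, Finset.sum_mul]
  rw [Finset.sum_comm]
  refine Finset.sum_congr rfl fun B hB => ?_
  rw [integral_comp_subset (A := A) (fun σ => (childData_subset B (pick n B) σ t).trans
    (Finset.mem_powerset.mp hB)) (fun C => measurableSet_childData B (pick n B) t {C}),
    Finset.mul_sum]
  exact Finset.sum_congr rfl fun C _ => by ring

/-- The nodes at depth `k`. -/
def nodesAt : ℕ → Finset Node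
  | 0 => {[]}
  | k + 1 => (nodesAt k).image (List.cons true) ∪ (nodesAt k).image (List.cons false)

lemma mem_nodesAt {k : ℕ} {n : Node} (h : n.length = k) : n ∈ nodesAt k := by
  induction k generalizing n with
  | zero => simpa [nodesAt] using h
  | succ k ih =>
    obtain _ | ⟨t, n⟩ := n
    · simp at h
    · have := ih (n := n) (by simpa using h)
      cases t <;> simp [nodesAt, this]

lemma sum_nodesAt_succ (k : ℕ) (f : Node → ℝ) :
    ∑ n ∈ nodesAt (k + 1), f n = ∑ n ∈ nodesAt k, (f (true :: n) + f (false :: n)) := by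
  rw [nodesAt, Finset.sum_union, Finset.sum_image (by simp [Set.InjOn]),
    Finset.sum_image (by simp [Set.InjOn]), Finset.sum_add_distrib]
  rw [Finset.disjoint_left]
  simp

/-- If splitting any cell contracts a potential by the factor `lam` in the mean, then its expected
total over the cells at depth `k` is contracted by `lam ^ k`. -/
lemma sum_integral_cellData_le {A : Finset (Pt D)} {pick : Node → Finset (Pt D) → Pt D}
    {g : Finset (Pt D) → ℝ} {lam : ℝ} (hlam : 0 ≤ lam)
    (hg : ∀ n, ∀ B ⊆ A, ∫ σ, (g (childData B (pick n B) σ true) +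
      g (childData B (pick n B) σ false)) ∂(splitLaw D) ≤ lam * g B) (k : ℕ) :
    ∑ n ∈ nodesAt k, ∫ ω, g (cellData A pick ω n) ∂(treeLaw D) ≤ lam ^ k * g A := by
  induction k with
  | zero => simp [nodesAt, cellData]
  | succ k ih =>
    rw [sum_nodesAt_succ]
    calc _ ≤ ∑ n ∈ nodesAt k, lam * ∫ ω, g (cellData A pick ω n) ∂(treeLaw D) := by
          refine Finset.sum_le_sum fun n _ => ?_
          rw [integral_cellData_cons, integral_cellData_cons, ← Finset.sum_add_distrib,
            integral_comp_subset (fun ω => cellData_subset A pick ω n)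
              (fun B => measurableSet_cellData A pick n {B}), Finset.mul_sum]
          refine Finset.sum_le_sum fun B hB => ?_
          have i : ∀ t, Integrable (fun σ => g (childData B (pick n B) σ t)) (splitLaw D) :=
            fun t => integrable_comp_subset (fun σ => childData_subset B (pick n B) σ t)
              (fun C => measurableSet_childData B (pick n B) t {C}) g
          rw [← mul_add, ← integral_add (i true) (i false), mul_left_comm]
          gcongr
          exact hg n B (Finset.mem_powerset.mp hB)
      _ = lam * ∑ n ∈ nodesAt k, ∫ ω, g (cellData A pick ω n) ∂(treeLaw D) := by
          rw [Finset.mul_sum]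
      _ ≤ lam * (lam ^ k * g A) := by gcongr
      _ = _ := by ring

/-- Union bound over the nodes at depth `k`, then Markov's inequality at each of them. -/
lemma treeLaw_real_exists_cellData_le {A : Finset (Pt D)} {pick : Node → Finset (Pt D) → Pt D}
    {g : Finset (Pt D) → ℝ} {lam : ℝ} (hlam : 0 ≤ lam) (hg0 : ∀ B, 0 ≤ g B)
    (hg : ∀ n, ∀ B ⊆ A, ∫ σ, (g (childData B (pick n B) σ true) +
      g (childData B (pick n B) σ false)) ∂(splitLaw D) ≤ lam * g B) (k : ℕ) :
    (treeLaw D).real {ω | ∃ n : Node, n.length = k ∧ 1 ≤ g (cellData A pick ω n)} ≤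
      lam ^ k * g A := by
  classical
  have hsub : {ω : Node → Split D | ∃ n : Node, n.length = k ∧ 1 ≤ g (cellData A pick ω n)} ⊆
      ⋃ n ∈ nodesAt k, {ω | 1 ≤ g (cellData A pick ω n)} := by
    rintro ω ⟨n, hn, h⟩
    simp only [Set.mem_iUnion]
    exact ⟨n, mem_nodesAt hn, h⟩
  refine (measureReal_mono hsub (measure_ne_top _ _)).trans ((measureReal_biUnion_finset_le _ _).trans ?_)
  refine le_trans (Finset.sum_le_sum fun n _ => ?_) (sum_integral_cellData_le hlam hg k)
  have hm : MeasurableSet {ω : Node → Split D | 1 ≤ g (cellData A pick ω n)} :=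
    measurableSet_cellData A pick n {B | 1 ≤ g B}
  rw [← integral_ite_one hm]
  refine integral_mono (integrable_ite_one hm) (integrable_comp_subset
    (fun ω => cellData_subset A pick ω n)
    (fun B => measurableSet_cellData A pick n {B}) g) fun ω => ?_
  dsimp only
  split_ifs with h
  · exact h
  · exact hg0 _

/-! ### Radius, diameter and doubling dimension. -/

lemma radius_nonneg (A : Finset (Pt D)) : 0 ≤ radius A :=
  Real.sInf_nonneg fun _ hr => hr.1

lemma radius_le {A : Finset (Pt D)} {r : ℝ} (hr : 0 ≤ r) {x : Pt D}
    (h : (A : Set (Pt D)) ⊆ Metric.closedBall x r) : radius A ≤ r :=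
  csInf_le ⟨0, fun _ h => h.1⟩ ⟨hr, x, h⟩

lemma exists_enclosing_radius (A : Finset (Pt D)) :
    {r : ℝ | 0 ≤ r ∧ ∃ x : Pt D, (A : Set (Pt D)) ⊆ Metric.closedBall x r}.Nonempty := by
  obtain ⟨r, hr⟩ := A.finite_toSet.isBounded.subset_closedBall (0 : Pt D)
  exact ⟨max r 0, le_max_right _ _, 0, hr.trans (Metric.closedBall_subset_closedBall (le_max_left _ _))⟩

lemma radius_mono {A B : Finset (Pt D)} (h : A ⊆ B) : radius A ≤ radius B :=
  csInf_le_csInf ⟨0, fun _ h => h.1⟩ (exists_enclosing_radius B) fun _ ⟨hr, x, hx⟩ =>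
    ⟨hr, x, (Finset.coe_subset.mpr h).trans hx⟩

lemma exists_subset_closedBall_of_radius_lt {A : Finset (Pt D)} {R : ℝ} (h : radius A < R) :
    ∃ x : Pt D, (A : Set (Pt D)) ⊆ Metric.closedBall x R := by
  obtain ⟨r, ⟨-, x, hx⟩, hr⟩ := exists_lt_of_csInf_lt (exists_enclosing_radius A) h
  exact ⟨x, hx.trans (Metric.closedBall_subset_closedBall hr.le)⟩

lemma exists_dist_gt_of_lt_radius {A : Finset (Pt D)} {ρ : ℝ} (hρ : 0 ≤ ρ) (h : ρ < radius A) :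
    ∃ x ∈ A, ∃ y ∈ A, ρ < dist x y := by
  by_contra! hcon
  refine absurd h (not_lt.mpr ?_)
  rcases A.eq_empty_or_nonempty with rfl | ⟨x, hx⟩
  · exact radius_le hρ (x := 0) (by simp)
  · exact radius_le hρ (x := x) fun y hy => hcon y hy x hx

lemma CoversByHalving.subset {S S' : Set (Pt D)} {d : ℕ} (h : CoversByHalving S d) (hS : S' ⊆ S) :
    CoversByHalving S' d := fun x r hr => by
  obtain ⟨T, hT, hc⟩ := h x r hr
  exact ⟨T, hT, (Set.inter_subset_inter_right _ hS).trans hc⟩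

lemma CoversByHalving.mono {S : Set (Pt D)} {d d' : ℕ} (h : CoversByHalving S d) (hd : d ≤ d') :
    CoversByHalving S d' := fun x r hr => by
  obtain ⟨T, hT, hc⟩ := h x r hr
  exact ⟨T, hT.trans (Nat.pow_le_pow_right two_pos hd), hc⟩

/-- A finite bound excludes the empty infimum `⊤`, so some covering exponent is at most `d`, and
exponents may be increased. -/
lemma coversByHalving_of_doublingDim_le {S : Set (Pt D)} {d : ℕ} (h : doublingDim S ≤ d) :
    CoversByHalving S d := by
  have h1 : doublingDim S < (d : ℕ∞) + 1 :=
    lt_of_le_of_lt h (by exact_mod_cast Nat.lt_succ_self d)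
  rw [doublingDim, iInf_lt_iff] at h1
  obtain ⟨⟨d', hd'⟩, hlt⟩ := h1
  have : d' < d + 1 := by exact_mod_cast hlt
  exact hd'.mono (by omega)

/-! ### Counting separated pairs: the two-scale potential. -/

open Classical in
/-- The number of well separated pairs of net balls that the set `A` meets. -/
noncomputable def pairCount (T : Finset (Pt D)) (r ρ : ℝ) (A : Finset (Pt D)) : ℝ :=
  ∑ q ∈ (T ×ˢ T).filter (fun q => ρ - 2 * r ≤ dist q.1 q.2), if MeetsBoth q.1 q.2 r A then 1 else 0

lemma pairCount_nonneg (T : Finset (Pt D)) (r ρ : ℝ) (A : Finset (Pt D)) :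
    0 ≤ pairCount T r ρ A :=
  Finset.sum_nonneg fun _ _ => by split_ifs <;> norm_num

lemma pairCount_le (T : Finset (Pt D)) (r ρ : ℝ) (A : Finset (Pt D)) :
    pairCount T r ρ A ≤ (T.card : ℝ) ^ 2 := by
  classical
  refine (Finset.sum_le_card_nsmul _ _ 1 fun q _ => by split_ifs <;> norm_num).trans ?_
  rw [nsmul_eq_mul, mul_one, sq, ← Nat.cast_mul, ← Finset.card_product]
  exact_mod_cast Finset.card_filter_le _ _

lemma one_le_pairCount {T : Finset (Pt D)} {r ρ : ℝ} {A : Finset (Pt D)}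
    (hT : ∀ z ∈ A, ∃ c ∈ T, dist z c ≤ r) {x y : Pt D} (hx : x ∈ A) (hy : y ∈ A)
    (hxy : ρ < dist x y) : 1 ≤ pairCount T r ρ A := by
  classical
  obtain ⟨c, hc, hxc⟩ := hT x hx
  obtain ⟨c', hc', hyc⟩ := hT y hy
  have hm : (c, c') ∈ (T ×ˢ T).filter (fun q => ρ - 2 * r ≤ dist q.1 q.2) := by
    refine Finset.mem_filter.mpr ⟨Finset.mem_product.mpr ⟨hc, hc'⟩, ?_⟩
    have := dist_triangle4 x c c' y
    rw [dist_comm c' y] at this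
    dsimp only
    linarith
  have hJ : MeetsBoth c c' r A := ⟨⟨x, hx, hxc⟩, y, hy, hyc⟩
  have h := Finset.single_le_sum
    (f := fun q : Pt D × Pt D => if MeetsBoth q.1 q.2 r A then (1 : ℝ) else 0)
    (fun q _ => by split_ifs <;> norm_num) hm
  rw [if_pos hJ] at h
  exact h

lemma pairCount_empty (T : Finset (Pt D)) (r ρ : ℝ) : pairCount T r ρ ∅ = 0 := by
  classical
  exact Finset.sum_eq_zero fun q _ => by simp [MeetsBoth]

lemma integrable_comp_childData (A : Finset (Pt D)) (p : Pt D) (t : Bool)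
    (g : Finset (Pt D) → ℝ) :
    Integrable (fun σ => g (childData A p σ t)) (splitLaw D) :=
  integrable_comp_subset (fun σ => childData_subset A p σ t)
    (fun C => measurableSet_childData A p t {C}) g

/-- Points of two counted balls are at least `ρ - 4 * r ≥ ρ / 2` apart, so the one-pair estimate
applies with `δ = ρ / 2` and is summed over the pairs. -/
lemma integral_pairCount_childData_le {A : Finset (Pt D)} {p : Pt D} (hp : p ∈ A) {d : ℕ}
    (hd : 1 ≤ d) (hA : CoversByHalving (A : Set (Pt D)) d) (T : Finset (Pt D)) {r ρ Λ : ℝ}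
    (hr : 0 < r) (hρ : 0 < ρ) (hrρ : 16640 * d * r ≤ ρ) (hΛ : maxDist A p ≤ Λ) :
    ∫ σ, (pairCount T r ρ (childData A p σ true) + pairCount T r ρ (childData A p σ false))
      ∂(splitLaw D) ≤ (1 - ρ / (192 * Λ)) * pairCount T r ρ A := by
  classical
  have hd' : (1 : ℝ) ≤ d := by exact_mod_cast hd
  have i : ∀ (c c' : Pt D), Integrable (fun σ =>
      ((if MeetsBoth c c' r (childData A p σ true) then (1 : ℝ) else 0) +
        (if MeetsBoth c c' r (childData A p σ false) then 1 else 0))) (splitLaw D) := fun c c' =>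
    (integrable_ite_one (measurableSet_childData A p true {B | MeetsBoth c c' r B})).add
      (integrable_ite_one (measurableSet_childData A p false {B | MeetsBoth c c' r B}))
  unfold pairCount
  simp_rw [← Finset.sum_add_distrib]
  rw [integral_finsetSum _ fun q _ => i q.1 q.2, Finset.mul_sum]
  refine Finset.sum_le_sum fun q hq => ?_
  obtain ⟨-, hq⟩ := Finset.mem_filter.mp hq
  by_cases hJ : MeetsBoth q.1 q.2 r A
  · rw [if_pos hJ, mul_one]
    refine (integral_meetsBoth_childData_le hp hd hA hr (half_pos hρ) (by linarith)
      hΛ (fun x y hx hy => ?_) hJ).trans (le_of_eq ?_)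
    · have := dist_triangle4 q.1 x y q.2
      rw [dist_comm q.1 x] at this
      nlinarith
    · rw [div_div, ← mul_assoc]
      norm_num
  · have h0 : ∀ σ t, ¬ MeetsBoth q.1 q.2 r (childData A p σ t) := fun σ t h =>
      hJ (h.mono (childData_subset _ _ _ _))
    simp [hJ, h0]

/-- The contracted potential: pairs at the fine scale `ρ₂`, plus heavily weighted pairs at the
coarse scale `ρ₁`. -/
lemma integral_potential_childData_le {A : Finset (Pt D)} {p : Pt D} (hp : p ∈ A) {d : ℕ}
    (hd : 1 ≤ d) (hA : CoversByHalving (A : Set (Pt D)) d) (T : Finset (Pt D)) {r Δ t : ℝ}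
    (hr : 0 < r) (hΔ : 0 < Δ) (ht : 1 ≤ t) (hrρ : 16640 * d * r ≤ Δ / t ^ 2)
    (hT : ∀ z ∈ A, ∃ c ∈ T, dist z c ≤ r) (hAΔ : maxDist A p ≤ 4 * Δ) :
    ∫ σ, ((pairCount T r (Δ / t ^ 2) (childData A p σ true) +
          (T.card : ℝ) ^ 2 * pairCount T r (Δ / t) (childData A p σ true)) +
        (pairCount T r (Δ / t ^ 2) (childData A p σ false) +
          (T.card : ℝ) ^ 2 * pairCount T r (Δ / t) (childData A p σ false))) ∂(splitLaw D) ≤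
      (1 - 1 / (1536 * t)) * (pairCount T r (Δ / t ^ 2) A +
        (T.card : ℝ) ^ 2 * pairCount T r (Δ / t) A) := by
  have ht0 : 0 < t := by linarith
  have hρ : Δ / t ^ 2 ≤ Δ / t := by gcongr; exact le_self_pow₀ ht two_ne_zero
  have i := fun ρ b => integrable_comp_childData A p b (pairCount T r ρ)
  have h1 := integral_pairCount_childData_le hp hd hA T hr (div_pos hΔ ht0) (hrρ.trans hρ) hAΔ
  have e1 : Δ / t / (192 * (4 * Δ)) = 2 * (1 / (1536 * t)) := by field_simp; norm_num
  rw [e1] at h1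
  have hsplit : ∫ σ, ((pairCount T r (Δ / t ^ 2) (childData A p σ true) +
          (T.card : ℝ) ^ 2 * pairCount T r (Δ / t) (childData A p σ true)) +
        (pairCount T r (Δ / t ^ 2) (childData A p σ false) +
          (T.card : ℝ) ^ 2 * pairCount T r (Δ / t) (childData A p σ false))) ∂(splitLaw D) =
      ∫ σ, (pairCount T r (Δ / t ^ 2) (childData A p σ true) +
          pairCount T r (Δ / t ^ 2) (childData A p σ false)) ∂(splitLaw D) +
        (T.card : ℝ) ^ 2 * ∫ σ, (pairCount T r (Δ / t) (childData A p σ true) +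
          pairCount T r (Δ / t) (childData A p σ false)) ∂(splitLaw D) := by
    have j : ∀ ρ, Integrable (fun σ => pairCount T r ρ (childData A p σ true) +
      pairCount T r ρ (childData A p σ false)) (splitLaw D) := fun ρ => (i _ _).add (i _ _)
    rw [← integral_const_mul, ← integral_add (j _) ((j _).const_mul _)]
    congr 1
    ext σ
    ring
  rw [hsplit]
  have hη : 0 < 1 / (1536 * t) := by positivity
  set η := 1 / (1536 * t) with hηdef
  have h2n := pairCount_nonneg T r (Δ / t ^ 2) A
  have h1n := pairCount_nonneg T r (Δ / t) A
  have h2le := pairCount_le T r (Δ / t ^ 2) A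
  have hN : (0 : ℝ) ≤ (T.card : ℝ) ^ 2 := by positivity
  have h1' := mul_le_mul_of_nonneg_left h1 hN
  -- Write `η = 1 / (1536 * t)`. The coarse count always contracts at rate `2 * η`. If the cell has
  -- diameter at most `Δ / t`, the fine count contracts at rate `8 * η`. Otherwise some coarse pair
  -- is present, so the weighted coarse term dominates the fine count and its surplus `η` pays for
  -- the fine term, which need only not grow.
  by_cases hsmall : ∀ x ∈ A, ∀ y ∈ A, dist x y ≤ Δ / t
  · have h2 := integral_pairCount_childData_le hp hd hA T hr (div_pos hΔ (pow_pos ht0 2)) hrρ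
      (maxDist_le ⟨p, hp⟩ (hsmall p hp))
    have e2 : Δ / t ^ 2 / (192 * (Δ / t)) = 8 * η := by rw [hηdef]; field_simp; norm_num
    rw [e2] at h2
    have := mul_nonneg hη.le h2n
    have := mul_nonneg hη.le (mul_nonneg hN h1n)
    linarith
  · push Not at hsmall
    obtain ⟨x, hx, y, hy, hxy⟩ := hsmall
    have hone := one_le_pairCount hT hx hy hxy
    have h2 := integral_pairCount_childData_le hp hd hA T hr (div_pos hΔ (pow_pos ht0 2)) hrρ hAΔ
    have h3 : 0 ≤ Δ / t ^ 2 / (192 * (4 * Δ)) * pairCount T r (Δ / t ^ 2) A :=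
      mul_nonneg (by positivity) h2n
    have h4 : pairCount T r (Δ / t ^ 2) A ≤ (T.card : ℝ) ^ 2 * pairCount T r (Δ / t) A :=
      h2le.trans (le_mul_of_one_le_right hN hone)
    have := mul_le_mul_of_nonneg_left h4 hη.le
    linarith

/-! ### The number of levels and the probability bound. -/

/-- The dependence on `s` is absorbed through `log s ≤ 2 * √s`, so that `√s * log s` is of order
`s`. The constant comes from `1536 * (3 + 88) = 139776`. -/
lemma log_bound {d : ℕ} (hd : 2 ≤ d) {s : ℝ} (hs : 2 ≤ s) :
    1536 * √s * (3 * Real.log 2 + 4 * d * Real.log (66560 * d * s)) ≤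
      140000 * s * (d * Real.log d) := by
  have hd' : (2 : ℝ) ≤ d := by exact_mod_cast hd
  have hs0 : 0 < s := by linarith
  have hl : Real.log 2 ≤ Real.log d := Real.log_le_log two_pos hd'
  have hl2 : 1 / 2 < Real.log 2 := by linarith [Real.log_two_gt_d9]
  have hq : 1 ≤ √s := Real.one_le_sqrt.mpr (by linarith)
  have hqq : √s * √s = s := Real.mul_self_sqrt hs0.le
  have hc : Real.log 66560 ≤ 17 * Real.log 2 := by
    rw [← Real.log_rpow two_pos]
    exact Real.log_le_log (by norm_num) (by norm_num)
  have hls : Real.log s ≤ 2 * √s := by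
    rw [← hqq, Real.log_mul (by positivity) (by positivity)]
    have := Real.log_le_sub_one_of_pos (x := √s) (by positivity)
    rw [hqq]
    linarith
  have hlog : Real.log (66560 * d * s) ≤ 22 * (√s * Real.log d) := by
    rw [Real.log_mul (by positivity) (by positivity), Real.log_mul (by positivity) (by positivity)]
    nlinarith
  have h3 : 3 * Real.log 2 ≤ 3 * (d * (√s * Real.log d)) := by
    have h5 : Real.log d ≤ √s * Real.log d := by nlinarith
    nlinarith
  have h4 : 4 * d * Real.log (66560 * d * s) ≤ 88 * (d * (√s * Real.log d)) := by
    have := mul_le_mul_of_nonneg_left hlog (show (0 : ℝ) ≤ 4 * d by positivity)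
    linarith
  have hpos : 0 ≤ s * (d * Real.log d) := by
    have : 0 ≤ Real.log d := by linarith
    positivity
  calc _ ≤ 1536 * √s * (91 * (d * (√s * Real.log d))) := by gcongr; linarith
    _ = 1536 * 91 * (√s * √s) * (d * Real.log d) := by ring
    _ ≤ _ := by rw [hqq]; nlinarith

lemma one_sub_pow_mul_le {x N : ℝ} {K : ℕ} (hx : x ≤ 1) (hN : 0 < N)
    (h : 3 * Real.log 2 + Real.log N ≤ x * K) : (1 - x) ^ K * (2 * N) ≤ 1 / 4 := by
  have h1 : (1 - x) ^ K ≤ Real.exp (-(x * K)) := by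
    rw [show -(x * K) = K * (-x) by ring, Real.exp_nat_mul]
    exact pow_le_pow_left₀ (by linarith) (by linarith [Real.add_one_le_exp (-x)]) K
  have h2 : Real.exp (-(x * K)) ≤ (8 * N)⁻¹ := by
    rw [← Real.exp_log (show 0 < (8 * N)⁻¹ by positivity), Real.log_inv,
      Real.log_mul (by norm_num) hN.ne', show (8 : ℝ) = 2 ^ 3 by norm_num, Real.log_pow]
    gcongr
    push_cast
    exact h
  calc (1 - x) ^ K * (2 * N) ≤ (8 * N)⁻¹ * (2 * N) := by gcongr; exact h1.trans h2
    _ = _ := by field_simp; norm_num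

/-- With probability at least `3 / 4`, all cells `K` levels below a cell of radius `Δ` have diameter
at most `Δ / s`. -/
lemma treeLaw_real_exists_dist_gt_le {A : Finset (Pt D)} {pick : Node → Finset (Pt D) → Pt D}
    (hpick : ∀ n B, B.Nonempty → pick n B ∈ B) {d : ℕ} (hd : 2 ≤ d)
    (hA : CoversByHalving (A : Set (Pt D)) d) {Δ : ℝ} (hΔ : 0 < Δ) {x₀ : Pt D}
    (hAx : ∀ z ∈ A, dist z x₀ ≤ 2 * Δ) {s : ℝ} (hs : 2 ≤ s) {K : ℕ}
    (hK : 140000 * s * (d * Real.log d) ≤ K) :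
    (treeLaw D).real {ω | ∃ n : Node, n.length = K ∧ ∃ x ∈ cellData A pick ω n,
      ∃ y ∈ cellData A pick ω n, Δ / s < dist x y} ≤ 1 / 4 := by
  have hd' : (2 : ℝ) ≤ d := by exact_mod_cast hd
  have hs0 : 0 < s := by linarith
  have ht1 : 1 ≤ √s := Real.one_le_sqrt.mpr (by linarith)
  have hts : √s ^ 2 = s := Real.sq_sqrt hs0.le
  -- The least power of two above `33280 * d * s` makes the net fine enough for the scale `Δ / s`,
  -- while `2 ^ (m + 1) ≤ 66560 * d * s` keeps it small.
  obtain ⟨m, hm1, hm2⟩ := exists_nat_pow_near (x := 33280 * d * s) (y := (2 : ℝ))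
    (by nlinarith) one_lt_two
  obtain ⟨T, hTcard, hT⟩ := hA.exists_net x₀ (r := 2 * Δ) (by positivity) (m + 1)
  obtain ⟨r, hr⟩ : ∃ r : ℝ, r = 2 * Δ / 2 ^ (m + 1) := ⟨_, rfl⟩
  have hr0 : 0 < r := by rw [hr]; positivity
  have hrρ : 16640 * d * r ≤ Δ / √s ^ 2 := by
    rw [hts, hr, ← mul_div_assoc, div_le_div_iff₀ (by positivity) hs0]
    nlinarith
  have hTA : ∀ z ∈ A, ∃ c ∈ T, dist z c ≤ r := fun z hz => by
    rw [hr]; exact hT z hz (hAx z hz)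
  let g : Finset (Pt D) → ℝ := fun B => pairCount T r (Δ / √s ^ 2) B +
        (T.card : ℝ) ^ 2 * pairCount T r (Δ / √s) B
  have hg0 : ∀ B, 0 ≤ g B := fun B => add_nonneg (pairCount_nonneg _ _ _ _)
    (mul_nonneg (by positivity) (pairCount_nonneg _ _ _ _))
  have hη : 1 / (1536 * √s) ≤ 1 := by
    rw [div_le_one (by positivity)]; linarith
  have hg : ∀ n, ∀ B ⊆ A, ∫ σ, (g (childData B (pick n B) σ true) +
      g (childData B (pick n B) σ false)) ∂(splitLaw D) ≤ (1 - 1 / (1536 * √s)) * g B := by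
    intro n B hBA
    -- In an empty cell the picked point is unconstrained, but all the counts vanish.
    rcases B.eq_empty_or_nonempty with rfl | hB
    · have h1 : ∀ σ t, childData (∅ : Finset (Pt D)) (pick n ∅) σ t = ∅ := fun σ t =>
        Finset.subset_empty.mp (childData_subset _ _ _ _)
      simp [h1, g, pairCount_empty]
    · refine integral_potential_childData_le (hpick n B hB) (by omega)
        (hA.subset (Finset.coe_subset.mpr hBA)) T hr0 hΔ ht1 hrρ (fun z hz => hTA z (hBA hz))
        (maxDist_le hB fun z hz => ?_)
      have := dist_triangle_right (pick n B) z x₀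
      linarith [hAx z (hBA hz), hAx _ (hBA (hpick n B hB))]
  have hmain := treeLaw_real_exists_cellData_le (pick := pick) (by linarith) hg0 hg K
  refine (measureReal_mono ?_ (measure_ne_top _ _)).trans (hmain.trans ?_)
  · rintro ω ⟨n, hn, x, hx, y, hy, hxy⟩
    refine ⟨n, hn, ?_⟩
    have h1 : 1 ≤ pairCount T r (Δ / √s ^ 2) (cellData A pick ω n) :=
      one_le_pairCount (fun z hz => hTA z (cellData_subset A pick ω n hz)) hx hy (by rwa [hts])
    have h2 := mul_nonneg (sq_nonneg (T.card : ℝ))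
      (pairCount_nonneg T r (Δ / √s) (cellData A pick ω n))
    simp only [g]
    linarith
  · obtain ⟨N, hN⟩ : ∃ N : ℝ, N = ((2 : ℝ) ^ (d * (m + 1))) ^ 4 := ⟨_, rfl⟩
    have hN0 : 0 < N := by rw [hN]; positivity
    have hgA : g A ≤ 2 * N := by
      have hc : (T.card : ℝ) ≤ 2 ^ (d * (m + 1)) := by exact_mod_cast hTcard
      have h1 : (1 : ℝ) ≤ 2 ^ (d * (m + 1)) := one_le_pow₀ one_le_two
      calc g A ≤ (T.card : ℝ) ^ 2 + (T.card : ℝ) ^ 2 * (T.card : ℝ) ^ 2 :=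
            add_le_add (pairCount_le _ _ _ _)
              (mul_le_mul_of_nonneg_left (pairCount_le _ _ _ _) (by positivity))
        _ ≤ (2 ^ (d * (m + 1))) ^ 2 + (2 ^ (d * (m + 1))) ^ 2 * (2 ^ (d * (m + 1))) ^ 2 := by
            gcongr
        _ ≤ (2 ^ (d * (m + 1))) ^ 4 + (2 ^ (d * (m + 1))) ^ 2 * (2 ^ (d * (m + 1))) ^ 2 := by
            gcongr
            norm_num
        _ = _ := by rw [hN]; ring
    have hlogN : Real.log N ≤ 4 * d * Real.log (66560 * d * s) := by
      have h1 : Real.log ((2 : ℝ) ^ (m + 1)) ≤ Real.log (66560 * d * s) := by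
        refine Real.log_le_log (by positivity) ?_
        rw [pow_succ]
        linarith
      rw [hN, mul_comm d, pow_mul, ← pow_mul, Real.log_pow]
      push_cast
      rw [mul_comm (d : ℝ) 4]
      gcongr
    refine (mul_le_mul_of_nonneg_left hgA (pow_nonneg (by linarith) K)).trans
      (one_sub_pow_mul_le hη hN0 ?_)
    rw [div_mul_eq_mul_div, one_mul, le_div_iff₀ (by positivity)]
    refine le_trans ?_ ((log_bound hd hs).trans hK)
    rw [mul_comm]
    gcongr

/-! ### Restarting the tree at a given node. -/

/-- The subtree rooted at `w` is a tree grown from the cell at `w`. -/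
lemma cellData_rerandomize_append (S : Finset (Pt D)) (pick : Node → Finset (Pt D) → Pt D)
    (w : Node) (ω₀ ω : Node → Split D) (u : Node) :
    cellData S pick (rerandomize w ω₀ ω) (u ++ w) =
      cellData (cellData S pick ω₀ w) (fun n => pick (n ++ w)) (fun n => ω (n ++ w)) u := by
  induction u with
  | nil =>
    refine cellData_congr fun m hm hmw => if_neg fun h => hmw ?_
    exact hm.eq_of_length_le h.length_le
  | cons t u ih =>
    have h1 : rerandomize w ω₀ ω (u ++ w) = ω (u ++ w) := if_pos (List.suffix_append u w)
    simp only [List.cons_append, cellData, ih, h1]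

/-- Appending `w` is injective on nodes, so this merely selects a subfamily of the independent,
identically distributed splits. -/
lemma map_treeLaw_append (w : Node) :
    (treeLaw D).map (fun ω n => ω (n ++ w)) = treeLaw D :=
  Measure.map_infinitePi_infinitePi_of_inj (P := fun _ : Node => splitLaw D)
    (List.append_left_injective w)

end RPTree

open RPTree in
/-- RPTree-Max is built from the data set `S`; `w` is any of its nodes. All the randomness outside
the subtree rooted at `w` is fixed to `ω₀`, which determines the cell `C` at `w`; the probability is
over the randomization in constructing the subtree rooted at `C`. -/
theorem theorem1 :
    ∃ c₂ : ℝ, 0 < c₂ ∧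
      ∀ (D : ℕ) (S : Finset (Pt D)) (pick : Node → Finset (Pt D) → Pt D),
        (∀ (n : Node) (A : Finset (Pt D)), A.Nonempty → pick n A ∈ A) →
      ∀ (w : Node) (ω₀ : Node → Split D) (d : ℕ), 2 ≤ d →
        doublingDim (cellData S pick ω₀ w : Set (Pt D)) ≤ (d : ℕ∞) →
      ∀ s : ℝ, 2 ≤ s →
        (1 - 1 / 4 : ENNReal) ≤ treeLaw D {ω | ∀ u : List Bool,
          c₂ * s * (d * Real.log d) < (u.length : ℝ) →
            radius (cellData S pick (rerandomize w ω₀ ω) (u ++ w)) ≤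
              radius (cellData S pick ω₀ w) / s} := by
  refine ⟨140000, by norm_num, fun D S pick hpick w ω₀ d hd hdim s hs => ?_⟩
  simp_rw [cellData_rerandomize_append]
  set A := cellData S pick ω₀ w with hAdef
  have hs0 : 0 < s := by linarith
  set good : Set (Node → Split D) := {ω | ∀ u : List Bool,
    140000 * s * (d * Real.log d) < (u.length : ℝ) →
      radius (cellData A (fun n => pick (n ++ w)) (fun n => ω (n ++ w)) u) ≤ radius A / s}
  suffices h : treeLaw D goodᶜ ≤ 1 / 4 by
    rw [tsub_le_iff_right]
    calc (1 : ENNReal) = treeLaw D Set.univ := measure_univ.symm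
      _ ≤ treeLaw D good + treeLaw D goodᶜ := by
        rw [← Set.union_compl_self good]; exact measure_union_le _ _
      _ ≤ _ := by gcongr
  rcases (radius_nonneg A).eq_or_lt with h0 | hΔ
  · have : goodᶜ = ∅ := by
      rw [Set.compl_empty_iff, Set.eq_univ_iff_forall]
      intro ω u _
      rw [← h0, zero_div, h0]
      exact radius_mono (cellData_subset _ _ _ _)
    simp [this]
  -- Doubling the positive radius avoids having to show that the infimum is attained, and makes all
  -- distances at most `4 * radius A`.
  obtain ⟨x₀, hx₀⟩ := exists_subset_closedBall_of_radius_lt (show radius A < 2 * radius A by linarith)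
  set K := ⌈140000 * s * (d * Real.log d)⌉₊ with hK
  set bad : Set (Node → Split D) := {ω | ∃ n : Node, n.length = K ∧
    ∃ x ∈ cellData A (fun n => pick (n ++ w)) ω n,
      ∃ y ∈ cellData A (fun n => pick (n ++ w)) ω n, radius A / s < dist x y}
  have hbad : (treeLaw D).real bad ≤ 1 / 4 :=
    treeLaw_real_exists_dist_gt_le (fun n B hB => hpick (n ++ w) B hB) hd
      (coversByHalving_of_doublingDim_le hdim) hΔ (fun z hz => hx₀ hz) hs (Nat.le_ceil _)
  have hsub : goodᶜ ⊆ (fun (ω : Node → Split D) n => ω (n ++ w)) ⁻¹' bad := by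
    intro ω hω
    simp only [good, Set.mem_compl_iff, Set.mem_ofPred_eq, not_forall, not_le] at hω
    obtain ⟨u, hu, hrad⟩ := hω
    have hlen : K ≤ u.length := Nat.ceil_le.mpr hu.le
    -- The most recent turns come first, so dropping them leads to the ancestor exactly `K` levels
    -- down. Its cell contains the cell at `u`, so only one depth has to be controlled.
    refine ⟨u.drop (u.length - K), by rw [List.length_drop]; omega,
      exists_dist_gt_of_lt_radius (by positivity) (hrad.trans_le (radius_mono ?_))⟩
    conv_lhs => rw [← List.take_append_drop (u.length - K) u]
    exact cellData_append_subset _ _ _ _ _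
  -- Only subadditivity and `Measure.le_map_apply` are used, so neither `good` nor `bad` has to be
  -- shown measurable.
  calc treeLaw D goodᶜ ≤ treeLaw D ((fun (ω : Node → Split D) n => ω (n ++ w)) ⁻¹' bad) :=
        measure_mono hsub
    _ ≤ (treeLaw D).map (fun ω n => ω (n ++ w)) bad :=
        Measure.le_map_apply
          (measurable_pi_lambda _ fun n => measurable_pi_apply (n ++ w)).aemeasurable _
    _ = ENNReal.ofReal ((treeLaw D).real bad) := by
        rw [map_treeLaw_append, ofReal_measureReal]
    _ ≤ ENNReal.ofReal (1 / 4) := ENNReal.ofReal_le_ofReal hbad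
    _ = 1 / 4 := by
        rw [ENNReal.ofReal_div_of_pos (by norm_num)]; simp
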